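/- Theorem 10.1. Let $r\ge 0$ and let $G=\langle s_1,\dots,s_r\rangle$ be either the free group or the free semigroup with identity on $s_1,\dots,s_r$. Put $S=\{s_1^{\pm1},\dots,s_r^{\pm1}\}$ in the group case and $S=\{s_1,\dots,s_r\}$ in the semigroup case, and let $B(e,n)\subset G$ be the set of products of at most $n$ elements of $S$. Let $T$ be an action of $G$ by measure-preserving maps on a probability space $(X,\mathcal B,\mu)$, and let $\alpha$ be a partition of $X$ into at most countably many measurable sets with finite Shannon entropy $H(\alpha)=-\sum_{A\in\alpha}\mu(A)\log\mu(A)<\infty$. For finite $Q\subset G$ let $\alpha^Q=\bigvee_{q\in Q}T_q^{-1}\alpha$, let $\alpha^n=\alpha^{B(e,n)}$, and define $$F(\alpha)=(1-2r)H(\alpha)+\sum_{i=1}^r H(\alpha\vee T_{s_i}^{-1}\alpha),\qquad f(\alpha)=\inf_{n>0}F(\alpha^n)\in[-\infty,\infty).$$ The left-Cayley graph of $(G,S)$ has vertex set $G$ and an edge between $g$ and $sg$ for all $g\in G$, $s\in S$. For $g_1,g_2\in G$, let $\mathrm{Past}(g_1;g_2)$ be the set of $h\in G$ such that every (undirected)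 path in this graph from $h$ to $g_1$ passes through $g_2$. The process $(T,X,\mu,\alpha)$ is called Markov if for all $s\in S$, $g\in G$ and $A\in\alpha$ $$\mu\Big(T_{sg}^{-1}A\,\Big|\,\bigvee_{h\in \mathrm{Past}(sg;g)}T_h^{-1}\alpha\Big)=\mu\big(T_{sg}^{-1}A\,\big|\,T_g^{-1}\alpha\big)\quad\mu\text{-almost everywhere},$$ where $\mu(\cdot|\mathcal F)$ denotes conditional probability with respect to the $\sigma$-algebra $\mathcal F$, and joins and partitions are identified with the $\sigma$-algebras they generate. Then $(T,X,\mu,\alpha)$ is Markov if and only if $F(\alpha)=f(\alpha)$. Corollary. Let $K$ be a finite or countable discrete set, let $T$ be the canonical action $(T_gx)(h)=x(hg)$ of $G$ on $K^G$, let $\mu$ be a $T$-invariant Borel probability measure on $K^G$, and let $\alpha=\{A_k: k\in K\}$ with $A_k=\{x: x(e)=k\}$ be the canonical partition. If $H(\alpha)<\infty$, then $f(\alpha)\le F(\alpha)$, with equality if and only if $(T,K^G,\mu,\alpha)$ is Markov. -/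

import Mathlib

open MeasureTheory
open scoped ENNReal

namespace FreeMarkov

/-- A partition of the measurable space `X`: a countable (finite or infinite) family of pairwise
disjoint measurable sets, called atoms, whose union is `X`. The empty set is allowed as an atom. -/
structure Partition (X : Type*) [MeasurableSpace X] where
  atoms : Set (Set X)
  countable : atoms.Countable
  measurable : ∀ A ∈ atoms, MeasurableSet A
  pairwiseDisjoint : atoms.PairwiseDisjoint id
  sUnion_eq : ⋃₀ atoms = Set.univ

namespace Partition

variable {X : Type*} [MeasurableSpace X]

/-- The `σ`-algebra generated by the atoms of a partition. -/
abbrev sigma (α : Partition X) : MeasurableSpace X :=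
  MeasurableSpace.generateFrom α.atoms

/-- The Shannon entropy `H(α) = -∑ μ(A) log μ(A)`, with values in `[0, ∞]` (for a probability
measure all terms are nonnegative). -/
noncomputable def entropy (μ : Measure X) (α : Partition X) : ℝ≥0∞ :=
  ∑' A : α.atoms, ENNReal.ofReal (Real.negMulLog (μ.real (A : Set X)))

/-- The common refinement `α ∨ β = {A ∩ B | A ∈ α, B ∈ β}`. -/
def join (α β : Partition X) : Partition X where
  atoms := Set.image2 (fun A B => A ∩ B) α.atoms β.atoms
  countable := α.countable.image2 β.countable _
  measurable := by
    rintro _ ⟨A, hA, B, hB, rfl⟩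
    exact (α.measurable A hA).inter (β.measurable B hB)
  pairwiseDisjoint := by
    rintro _ ⟨A, hA, B, hB, rfl⟩ _ ⟨A', hA', B', hB', rfl⟩ hne
    by_cases h : A = A'
    · have hB' : B ≠ B' := by
        rintro rfl
        exact hne (by rw [h])
      exact (β.pairwiseDisjoint hB ‹_› hB').mono Set.inter_subset_right Set.inter_subset_right
    · exact (α.pairwiseDisjoint hA hA' h).mono Set.inter_subset_left Set.inter_subset_left
  sUnion_eq := by
    refine Set.eq_univ_of_forall fun x => ?_
    obtain ⟨A, hA, hxA⟩ : x ∈ ⋃₀ α.atoms := by rw [α.sUnion_eq]; trivial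
    obtain ⟨B, hB, hxB⟩ : x ∈ ⋃₀ β.atoms := by rw [β.sUnion_eq]; trivial
    exact ⟨A ∩ B, ⟨A, hA, B, hB, rfl⟩, hxA, hxB⟩

end Partition

/-- A measure-preserving action `T` of a monoid (or group) `G` on `(X, μ)`: a homomorphism
`g ↦ T_g` from `G` to the monoid of measure-preserving self-maps of `X` (under composition). -/
structure Action (G : Type*) [Monoid G] {X : Type*} [MeasurableSpace X] (μ : Measure X) where
  map : G →* Function.End X
  measurePreserving : ∀ g, MeasurePreserving (map g) μ μ

section Actions

variable {G : Type*} [Monoid G] {X : Type*} [MeasurableSpace X] {μ : Measure X}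

/-- The partition `T_g⁻¹ α = {T_g⁻¹ A | A ∈ α}`. -/
def Action.pullback (T : Action G μ) (g : G) (α : Partition X) : Partition X where
  atoms := (fun A => T.map g ⁻¹' A) '' α.atoms
  countable := α.countable.image _
  measurable := by
    rintro _ ⟨A, hA, rfl⟩
    exact (T.measurePreserving g).measurable (α.measurable A hA)
  pairwiseDisjoint := by
    rintro _ ⟨A, hA, rfl⟩ _ ⟨A', hA', rfl⟩ hne
    have h : A ≠ A' := by
      rintro rfl
      exact hne rfl
    exact (α.pairwiseDisjoint hA hA' h).preimage _
  sUnion_eq := by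
    refine Set.eq_univ_of_forall fun x => ?_
    obtain ⟨A, hA, hxA⟩ : T.map g x ∈ ⋃₀ α.atoms := by rw [α.sUnion_eq]; trivial
    exact ⟨_, ⟨A, hA, rfl⟩, hxA⟩

/-- The partition `α^Q = ⋁_{q ∈ Q} T_q⁻¹ α` for a finite set `Q ⊆ G`: its atoms are the
intersections `⋂_{q ∈ Q} T_q⁻¹ A_q` with all `A_q` atoms of `α`. -/
def Action.refine (T : Action G μ) (α : Partition X) (Q : Set G) [Finite Q] : Partition X where
  atoms := Set.range fun A : Q → α.atoms => ⋂ q : Q, T.map (q : G) ⁻¹' (A q : Set X)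
  countable := by
    have : Countable α.atoms := α.countable.to_subtype
    exact Set.countable_range _
  measurable := by
    rintro _ ⟨A, rfl⟩
    exact MeasurableSet.iInter fun q =>
      (T.measurePreserving (q : G)).measurable (α.measurable _ (A q).2)
  pairwiseDisjoint := by
    rintro _ ⟨A, rfl⟩ _ ⟨A', rfl⟩ hne
    have h : A ≠ A' := by
      rintro rfl
      exact hne rfl
    obtain ⟨q, hq⟩ := Function.ne_iff.1 h
    have hd : Disjoint (A q : Set X) (A' q : Set X) :=
      α.pairwiseDisjoint (A q).2 (A' q).2 fun he => hq (Subtype.ext he)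
    exact (hd.preimage (T.map (q : G))).mono (Set.iInter_subset _ q) (Set.iInter_subset _ q)
  sUnion_eq := by
    refine Set.eq_univ_of_forall fun x => ?_
    have h : ∀ q : Q, ∃ A : α.atoms, T.map (q : G) x ∈ (A : Set X) := by
      intro q
      obtain ⟨A, hA, hxA⟩ : T.map (q : G) x ∈ ⋃₀ α.atoms := by rw [α.sUnion_eq]; trivial
      exact ⟨⟨A, hA⟩, hxA⟩
    choose A hA using h
    exact ⟨_, ⟨A, rfl⟩, Set.mem_iInter.2 hA⟩

/-- The ball `B(e, n)` around the identity for the word metric of the generating set `S`: the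
products of at most `n` elements of `S`. -/
def ball (S : Set G) (n : ℕ) : Set G :=
  {g | ∃ l : List S, l.length ≤ n ∧ (l.map Subtype.val).prod = g}

instance instFiniteBall (S : Set G) [Finite S] (n : ℕ) : Finite (ball S n) := by
  have h : (ball S n).Finite := by
    refine ((List.finite_length_le S n).image fun l => (l.map Subtype.val).prod).subset ?_
    rintro g ⟨l, hl, rfl⟩
    exact ⟨l, hl, rfl⟩
  exact h.to_subtype

/-- `F(T, α) = (1 - 2r) H(α) + ∑ᵢ H(α ∨ T_{sᵢ}⁻¹ α)`, where `s₁, …, s_r` are the free generators.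
It is meaningful for partitions of finite entropy. -/
noncomputable def Action.bigF (T : Action G μ) {r : ℕ} (s : Fin r → G) (α : Partition X) : ℝ :=
  (1 - 2 * (r : ℝ)) * (α.entropy μ).toReal
    + ∑ i : Fin r, ((α.join (T.pullback (s i) α)).entropy μ).toReal

/-- `f(T, α) = inf_{n > 0} F(T, α^n)` with `α^n = α^{B(e, n)}`, an infimum in the extended reals
(it may be `-∞`). -/
noncomputable def Action.littleF (T : Action G μ) {r : ℕ} (s : Fin r → G) (S : Set G) [Finite S]
    (α : Partition X) : EReal :=
  ⨅ (n : ℕ) (_ : 0 < n), ((T.bigF s (T.refine α (ball S n)) : ℝ) : EReal)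

/-- The left-Cayley graph: `g` is joined to `s * g` for all `g ∈ G`, `s ∈ S`. As usual for
connectedness and separation in a directed graph, the orientation of edges is forgotten. -/
def leftCayley (S : Set G) : SimpleGraph G :=
  SimpleGraph.fromRel fun g h => ∃ s ∈ S, h = s * g

/-- `Past(g₁; g₂)`: the elements `f` such that every path in the left-Cayley graph from `f` to
`g₁` passes through `g₂`. -/
def past (S : Set G) (g₁ g₂ : G) : Set G :=
  {f | ∀ p : (leftCayley S).Walk f g₁, g₂ ∈ p.support}

/-- The conditional probability `μ(A | m)`: the conditional expectation of the characteristic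
function of `A`. -/
noncomputable def condProb (μ : Measure X) (A : Set X) (m : MeasurableSpace X) : X → ℝ :=
  μ[A.indicator (fun _ => (1 : ℝ)) | m]

/-- The process `(T, X, μ, α)` is Markov: for all `s ∈ S`, `g ∈ G` and `A ∈ α`,
`μ(T_{sg}⁻¹ A | ⋁_{f ∈ Past(sg; g)} T_f⁻¹ α) = μ(T_{sg}⁻¹ A | T_g⁻¹ α)` almost everywhere. -/
def Action.IsMarkov (T : Action G μ) (S : Set G) (α : Partition X) : Prop :=
  ∀ s ∈ S, ∀ g : G, ∀ A ∈ α.atoms,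
    condProb μ (T.map (s * g) ⁻¹' A) (⨆ f ∈ past S (s * g) g, (T.pullback f α).sigma)
      =ᵐ[μ] condProb μ (T.map (s * g) ⁻¹' A) (T.pullback g α).sigma

end Actions

section Symbolic

/-- The canonical action of `G` on `K^G`: `(T_g x)(f) = x(f g)`. -/
def shift (G K : Type*) [Monoid G] : G →* Function.End (G → K) where
  toFun g := fun x f => x (f * g)
  map_one' := by
    funext x f
    change x (f * 1) = x f
    rw [mul_one]
  map_mul' g h := by
    funext x f
    change x (f * (g * h)) = x (f * g * h)
    rw [mul_assoc]

/-- The canonical action on `K^G` equipped with an invariant measure. -/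
def shiftAction {G K : Type*} [Monoid G] [MeasurableSpace K] (μ : Measure (G → K))
    (hμ : ∀ g : G, MeasurePreserving (shift G K g) μ μ) : Action G μ where
  map := shift G K
  measurePreserving := hμ

/-- The canonical partition `{A_k | k ∈ K}` of `K^G`, where `A_k = {x | x(e) = k}`. -/
def canonicalPartition (G K : Type*) [Monoid G] [Countable K] [MeasurableSpace K]
    [DiscreteMeasurableSpace K] : Partition (G → K) where
  atoms := Set.range fun k : K => {x : G → K | x 1 = k}
  countable := Set.countable_range _
  measurable := by
    rintro _ ⟨k, rfl⟩
    have h : Measurable fun x : G → K => x 1 := measurable_pi_apply 1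
    exact h (MeasurableSet.of_discrete (s := ({k} : Set K)))
  pairwiseDisjoint := by
    rintro _ ⟨k, rfl⟩ _ ⟨l, rfl⟩ hne
    refine Set.disjoint_left.2 fun x hx hy => hne ?_
    have hkl : k = l := Eq.trans (Eq.symm hx) hy
    rw [hkl]
  sUnion_eq := Set.eq_univ_of_forall fun x => ⟨_, ⟨x 1, rfl⟩, rfl⟩

end Symbolic

section Generators

/-- The symmetric generating set `S = {s₁^{±1}, …, s_r^{±1}}` of the free group of rank `r`. -/
def groupLetters (r : ℕ) : Set (FreeGroup (Fin r)) :=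
  Set.range FreeGroup.of ∪ Set.range fun i => (FreeGroup.of i)⁻¹

/-- The generating set `S = {s₁, …, s_r}` of the free semigroup with identity of rank `r`. -/
def monoidLetters (r : ℕ) : Set (FreeMonoid (Fin r)) :=
  Set.range FreeMonoid.of

instance instFiniteGroupLetters (r : ℕ) : Finite (groupLetters r) :=
  ((Set.finite_range _).union (Set.finite_range _)).to_subtype

instance instFiniteMonoidLetters (r : ℕ) : Finite (monoidLetters r) :=
  (Set.finite_range _).to_subtype

end Generators

end FreeMarkov

/-! For finite `Q ⊂ G` let `H Q` be the entropy of `α^Q`. This set function is submodular and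
invariant under right translation `Q ↦ Qg`; beyond these two facts only the tree structure of the
left-Cayley graph matters. The parent of a word is obtained by deleting its leftmost letter, while
right multiplication preserves adjacency.

Write `B n` for the balls. `B (n+1)` is covered by the sets `B n ∪ (B n)x`, any two of which meet in
`B n`, so submodularity bounds `H (B (n+1))` by entropies of these sets (`ball_succ_le`). Applied to
`B (n+1)` and its translate by `x` it bounds `H` of their union (`union_image_le`). The two bounds
add up to `F(α^(n+1)) ≤ F(α^n)`. Hence `f(α) ≤ F(α)`, with equality exactly when `n ↦ F(α^n)` is
constant, that is, when all these inequalities are equalities.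

Because entropies are finite, the Markov property across an edge is the vanishing of conditional
mutual informations, and so an identity between values of `H`: adding a leaf `c` to `P` costs `H
{parent c, c} - H {parent c}` (`EntropyMarkov`). Under this rule `H` is modular on the pairs of sets
used above (`LeafRule.modular`), so `F(α^n)` is constant.

For the converse, let `M` be the value the joint entropy would have for a Markov process with the
same edge marginals (`markovEntropy`). `M` is modular on these pairs, and `M - H` is nonnegative and
monotone on finite subtrees containing the root. Equality in the chain lets induction on `n` carry
`M = H` from `{1}` to every ball (`entropyMarkov_of_eq`); monotonicity gives it on every subtree
containing the root, and submodularity then yields the leaf identity in general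
(`entropyMarkov_of_ball_eq`). -/

namespace FreeMarkov

/-! ### Entropy and conditional mutual information of countably valued maps. -/

section RandomVariables

open Real

variable {X ι κ l : Type*} [MeasurableSpace X] {μ : Measure X}

/-- The Shannon entropy of a countably valued map. -/
noncomputable def ent (μ : Measure X) (φ : X → ι) : ℝ≥0∞ :=
  ∑' i, ENNReal.ofReal (negMulLog (μ.real (φ ⁻¹' {i})))

/-- The conditional Shannon entropy of `φ` given `ψ`. -/
noncomputable def condEnt (μ : Measure X) (φ : X → ι) (ψ : X → κ) : ℝ≥0∞ :=
  ∑' j, ∑' i, ENNReal.ofReal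
    (μ.real (ψ ⁻¹' {j}) * negMulLog (μ.real (φ ⁻¹' {i} ∩ ψ ⁻¹' {j}) / μ.real (ψ ⁻¹' {j})))

/-- The conditional mutual information of `φ` and `ψ` given `χ`. -/
noncomputable def condInfo (μ : Measure X) (φ : X → ι) (ψ : X → κ) (χ : X → l) : ℝ≥0∞ :=
  ∑' k, ∑' i, ∑' j, ENNReal.ofReal
    (μ.real (ψ ⁻¹' {j} ∩ χ ⁻¹' {k}) *
      (μ.real (φ ⁻¹' {i} ∩ χ ⁻¹' {k}) / μ.real (χ ⁻¹' {k}) *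
        InformationTheory.klFun
          (μ.real (φ ⁻¹' {i} ∩ (ψ ⁻¹' {j} ∩ χ ⁻¹' {k})) / μ.real (ψ ⁻¹' {j} ∩ χ ⁻¹' {k}) /
            (μ.real (φ ⁻¹' {i} ∩ χ ⁻¹' {k}) / μ.real (χ ⁻¹' {k})))))

/-- Values outside the range of `φ` have empty fibre and contribute `negMulLog 0 = 0`, so empty
atoms and the choice of index type are irrelevant. -/
theorem ent_eq_tsum_quotient (μ : Measure X) (φ : X → ι) :
    ent μ φ = ∑' q : Quotient (Setoid.ker φ),
      ENNReal.ofReal (negMulLog (μ.real {x | (Quotient.mk (Setoid.ker φ) x) = q})) := by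
  have hinj := Setoid.kerLift_injective φ
  rw [ent, ← hinj.tsum_eq]
  · refine tsum_congr fun q => ?_
    induction q using Quotient.inductionOn with
    | h y =>
      congr 4
      ext x
      simp only [Set.mem_preimage, Set.mem_singleton_iff, Set.mem_ofPred_eq, Quotient.eq]
      rfl
  · intro i hi
    by_contra hne
    apply hi
    have : φ ⁻¹' {i} = ∅ := by
      ext x
      simp only [Set.mem_preimage, Set.mem_singleton_iff, Set.mem_empty_iff_false, iff_false]
      rintro rfl
      exact hne ⟨Quotient.mk _ x, rfl⟩
    simp [this]

/-- The entropy depends only on the partition into fibres. -/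
theorem ent_congr {φ : X → ι} {ψ : X → κ} (h : ∀ x y, φ x = φ y ↔ ψ x = ψ y) :
    ent μ φ = ent μ ψ := by
  have hk : Setoid.ker φ = Setoid.ker ψ := Setoid.ext fun x y => h x y
  rw [ent_eq_tsum_quotient, ent_eq_tsum_quotient, hk]

theorem hasSum_measureReal_inter_fiber [IsFiniteMeasure μ] [Countable ι] {φ : X → ι}
    (hφ : ∀ i, MeasurableSet (φ ⁻¹' {i})) {E : Set X} (hE : MeasurableSet E) :
    HasSum (fun i => μ.real (φ ⁻¹' {i} ∩ E)) (μ.real E) := by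
  have h : μ E = ∑' i, μ (φ ⁻¹' {i} ∩ E) := by
    rw [← measure_iUnion]
    · congr 1
      ext x
      simp
    · intro i j hij
      refine Set.disjoint_left.2 ?_
      rintro x ⟨hx, -⟩ ⟨hy, -⟩
      exact hij (Eq.trans (Eq.symm hx) hy)
    · exact fun i => (hφ i).inter hE
  have h2 := ENNReal.hasSum_toReal (h ▸ measure_ne_top μ E)
  rw [← ENNReal.tsum_toReal_eq fun i => measure_ne_top μ _, ← h] at h2
  exact h2

theorem tsum_ofReal_of_hasSum {f : ι → ℝ} {a : ℝ} (hf : ∀ i, 0 ≤ f i) (h : HasSum f a) :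
    ∑' i, ENNReal.ofReal (f i) = ENNReal.ofReal a := by
  rw [← ENNReal.ofReal_tsum_of_nonneg hf h.summable, h.tsum_eq]

/-- The chain rule. -/
theorem ent_pair [IsProbabilityMeasure μ] [Countable ι] {φ : X → ι} {ψ : X → κ}
    (hφ : ∀ i, MeasurableSet (φ ⁻¹' {i})) (hψ : ∀ j, MeasurableSet (ψ ⁻¹' {j})) :
    ent μ (fun x => (φ x, ψ x)) = ent μ ψ + condEnt μ φ ψ := by
  have hpre : ∀ p : ι × κ, (fun x => (φ x, ψ x)) ⁻¹' {p} = φ ⁻¹' {p.1} ∩ ψ ⁻¹' {p.2} := by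
    rintro ⟨i, j⟩
    ext x
    simp
  rw [ent, tsum_congr fun p => by rw [hpre p],
    ENNReal.tsum_prod (f := fun i j => ENNReal.ofReal (negMulLog (μ.real (φ ⁻¹' {i} ∩ ψ ⁻¹' {j})))),
    ENNReal.tsum_comm, ent, condEnt, ← ENNReal.tsum_add]
  refine tsum_congr fun j => ?_
  set b := μ.real (ψ ⁻¹' {j})
  have hle : ∀ i, μ.real (φ ⁻¹' {i} ∩ ψ ⁻¹' {j}) ≤ b := fun i =>
    measureReal_mono Set.inter_subset_right
  have hs := hasSum_measureReal_inter_fiber (μ := μ) hφ (hψ j)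
  have hb0 : 0 ≤ b := measureReal_nonneg
  rcases hb0.eq_or_lt with hb | hb
  · have h0 : ∀ i, μ.real (φ ⁻¹' {i} ∩ ψ ⁻¹' {j}) = 0 := fun i =>
      le_antisymm ((hle i).trans hb.symm.le) measureReal_nonneg
    simp [h0, ← hb]
  have hb1 : b ≤ 1 := measureReal_le_one
  have hr0 : ∀ i, 0 ≤ μ.real (φ ⁻¹' {i} ∩ ψ ⁻¹' {j}) / b := fun i =>
    div_nonneg measureReal_nonneg hb0
  have hr1 : ∀ i, μ.real (φ ⁻¹' {i} ∩ ψ ⁻¹' {j}) / b ≤ 1 := fun i =>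
    div_le_one_of_le₀ (hle i) hb0
  -- With `η = negMulLog`, this is `η(xb) = x η(b) + b η(x)` for `x` the conditional probability of
  -- the fibre.
  have key : ∀ i, ENNReal.ofReal (negMulLog (μ.real (φ ⁻¹' {i} ∩ ψ ⁻¹' {j})))
      = ENNReal.ofReal (μ.real (φ ⁻¹' {i} ∩ ψ ⁻¹' {j}) / b * negMulLog b)
        + ENNReal.ofReal (b * negMulLog (μ.real (φ ⁻¹' {i} ∩ ψ ⁻¹' {j}) / b)) := by
    intro i
    rw [← ENNReal.ofReal_add (mul_nonneg (hr0 i) (negMulLog_nonneg hb0 hb1))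
      (mul_nonneg hb0 (negMulLog_nonneg (hr0 i) (hr1 i))), add_comm, ← negMulLog_mul,
      div_mul_cancel₀ _ hb.ne']
  rw [tsum_congr key, ENNReal.tsum_add]
  congr 1
  refine tsum_ofReal_of_hasSum (fun i => mul_nonneg (hr0 i) (negMulLog_nonneg hb0 hb1)) ?_
  have := (hs.div_const b).mul_right (negMulLog b)
  rwa [div_self hb.ne', one_mul] at this

/-- This is Jensen's inequality for `negMulLog` with its defect made explicit: with `x = q/p` and `y
= R/P`, the defect is the average of `y * klFun (x / y)`, the Bregman divergence. As every term is
nonnegative, the identity holds in `[0, ∞]` without any finiteness of entropy. -/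
theorem negMulLog_jensen_identity {p q : κ → ℝ} {P R : ℝ} (hq : ∀ j, 0 ≤ q j)
    (hqp : ∀ j, q j ≤ p j) (hp : HasSum p P) (hR : HasSum q R) :
    (∑' j, ENNReal.ofReal (p j * negMulLog (q j / p j))) +
      ∑' j, ENNReal.ofReal (p j * (R / P * InformationTheory.klFun (q j / p j / (R / P))))
      = ENNReal.ofReal (P * negMulLog (R / P)) := by
  have hp0 : ∀ j, 0 ≤ p j := fun j => (hq j).trans (hqp j)
  have hR0 : 0 ≤ R := hR.nonneg hq
  have hRP : R ≤ P := hasSum_le hqp hR hp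
  rcases hR0.eq_or_lt with h | h
  · have hq0 : q = 0 := (hasSum_zero_iff_of_nonneg hq).1 (h ▸ hR)
    simp [hq0, ← h]
  have hP : 0 < P := h.trans_le hRP
  set y := R / P with hy
  have hy0 : 0 < y := div_pos h hP
  have hy1 : y ≤ 1 := div_le_one_of_le₀ hRP hP.le
  have hlog : 0 ≤ -log y := by linarith [log_nonpos hy0.le hy1]
  have hx0 : ∀ j, 0 ≤ q j / p j := fun j => div_nonneg (hq j) (hp0 j)
  have hx1 : ∀ j, q j / p j ≤ 1 := fun j => div_le_one_of_le₀ (hqp j) (hp0 j)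
  have hpx : ∀ j, p j * (q j / p j) = q j := by
    intro j
    rcases (hp0 j).eq_or_lt with h0 | h0
    · have : q j = 0 := le_antisymm (h0 ▸ hqp j) (hq j)
      simp [this]
    · exact mul_div_cancel₀ _ h0.ne'
  have hk0 : ∀ j, 0 ≤ p j * (y * InformationTheory.klFun (q j / p j / y)) := fun j =>
    mul_nonneg (hp0 j) (mul_nonneg hy0.le (InformationTheory.klFun_nonneg
      (div_nonneg (hx0 j) hy0.le)))
  have hn0 : ∀ j, 0 ≤ p j * negMulLog (q j / p j) := fun j =>
    mul_nonneg (hp0 j) (negMulLog_nonneg (hx0 j) (hx1 j))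
  -- The linear term `q j` is moved to the left so that no subtraction occurs; after summation it
  -- cancels against `∑ p j * y = P * y = R`.
  have key : ∀ j, ENNReal.ofReal (p j * negMulLog (q j / p j))
      + ENNReal.ofReal (p j * (y * InformationTheory.klFun (q j / p j / y)))
      + ENNReal.ofReal (q j) = ENNReal.ofReal (q j * -log y) + ENNReal.ofReal (p j * y) := by
    intro j
    rw [← ENNReal.ofReal_add (hn0 j) (hk0 j), ← ENNReal.ofReal_add (add_nonneg (hn0 j) (hk0 j))
      (hq j), ← ENNReal.ofReal_add (mul_nonneg (hq j) hlog) (mul_nonneg (hp0 j) hy0.le)]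
    congr 1
    rcases (hx0 j).eq_or_lt with h0 | h0
    · have : q j = 0 := by rw [← hpx j, ← h0, mul_zero]
      simp [this, InformationTheory.klFun]
    · rw [InformationTheory.klFun, log_div h0.ne' hy0.ne', negMulLog]
      have e : y * (q j / p j / y * (log (q j / p j) - log y) + 1 - q j / p j / y)
          = q j / p j * (log (q j / p j) - log y) + y - q j / p j := by
        field_simp
      rw [e]
      linear_combination (-log y) * hpx j - hpx j
  have hsum := tsum_congr (L := .unconditional κ) key
  rw [ENNReal.tsum_add, ENNReal.tsum_add, ENNReal.tsum_add, tsum_ofReal_of_hasSum hq hR,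
    tsum_ofReal_of_hasSum (fun j => mul_nonneg (hq j) hlog) (hR.mul_right _),
    tsum_ofReal_of_hasSum (fun j => mul_nonneg (hp0 j) hy0.le) (hp.mul_right _)] at hsum
  have e1 : P * y = R := mul_div_cancel₀ _ hP.ne'
  rw [e1] at hsum
  rw [(ENNReal.add_left_inj ENNReal.ofReal_ne_top).1 hsum, negMulLog]
  congr 1
  linear_combination log y * e1

theorem condEnt_eq_add_condInfo [IsProbabilityMeasure μ] [Countable κ] {φ : X → ι}
    {ψ : X → κ} {χ : X → l} (hφ : ∀ i, MeasurableSet (φ ⁻¹' {i}))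
    (hψ : ∀ j, MeasurableSet (ψ ⁻¹' {j})) (hχ : ∀ k, MeasurableSet (χ ⁻¹' {k})) :
    condEnt μ φ χ = condEnt μ φ (fun x => (ψ x, χ x)) + condInfo μ φ ψ χ := by
  have hpre : ∀ p : κ × l, (fun x => (ψ x, χ x)) ⁻¹' {p} = ψ ⁻¹' {p.1} ∩ χ ⁻¹' {p.2} := by
    rintro ⟨i, j⟩
    ext x
    simp
  have h2 : condEnt μ φ (fun x => (ψ x, χ x)) = ∑' k, ∑' i, ∑' j, ENNReal.ofReal
      (μ.real (ψ ⁻¹' {j} ∩ χ ⁻¹' {k}) *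
        negMulLog (μ.real (φ ⁻¹' {i} ∩ (ψ ⁻¹' {j} ∩ χ ⁻¹' {k})) /
          μ.real (ψ ⁻¹' {j} ∩ χ ⁻¹' {k}))) := by
    rw [condEnt, tsum_congr fun p => by rw [hpre p], ENNReal.tsum_prod (f := fun j k =>
      ∑' i, ENNReal.ofReal (μ.real (ψ ⁻¹' {j} ∩ χ ⁻¹' {k}) *
        negMulLog (μ.real (φ ⁻¹' {i} ∩ (ψ ⁻¹' {j} ∩ χ ⁻¹' {k})) /
          μ.real (ψ ⁻¹' {j} ∩ χ ⁻¹' {k})))), ENNReal.tsum_comm]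
    exact tsum_congr fun k => ENNReal.tsum_comm
  rw [h2, condEnt, condInfo, ← ENNReal.tsum_add]
  refine tsum_congr fun k => ?_
  rw [← ENNReal.tsum_add]
  refine tsum_congr fun i => ?_
  refine (negMulLog_jensen_identity (fun j => measureReal_nonneg)
    (fun j => measureReal_mono Set.inter_subset_right)
    (hasSum_measureReal_inter_fiber hψ (hχ k)) ?_).symm
  have := hasSum_measureReal_inter_fiber (μ := μ) hψ ((hφ i).inter (hχ k))
  simpa only [Set.inter_left_comm] using this

/-- `klFun` is nonnegative and vanishes only at `1`, so zero information means conditional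
independence on each pair of fibres of positive measure. -/
theorem condInfo_eq_zero_iff [IsFiniteMeasure μ] {φ : X → ι} {ψ : X → κ} {χ : X → l} :
    condInfo μ φ ψ χ = 0 ↔ ∀ i j k, μ.real (ψ ⁻¹' {j} ∩ χ ⁻¹' {k}) ≠ 0 →
      μ.real (φ ⁻¹' {i} ∩ (ψ ⁻¹' {j} ∩ χ ⁻¹' {k})) / μ.real (ψ ⁻¹' {j} ∩ χ ⁻¹' {k})
        = μ.real (φ ⁻¹' {i} ∩ χ ⁻¹' {k}) / μ.real (χ ⁻¹' {k}) := by
  rw [condInfo]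
  simp only [ENNReal.tsum_eq_zero]
  have hall : ∀ {p : l → ι → κ → Prop} {q : ι → κ → l → Prop}, (∀ i j k, p k i j ↔ q i j k) →
      ((∀ k i j, p k i j) ↔ ∀ i j k, q i j k) := fun h =>
    ⟨fun h' i j k => (h i j k).1 (h' k i j), fun h' k i j => (h i j k).2 (h' i j k)⟩
  refine hall fun i j k => ?_
  set p := μ.real (ψ ⁻¹' {j} ∩ χ ⁻¹' {k}) with hp
  set q := μ.real (φ ⁻¹' {i} ∩ (ψ ⁻¹' {j} ∩ χ ⁻¹' {k})) with hq
  set y := μ.real (φ ⁻¹' {i} ∩ χ ⁻¹' {k}) / μ.real (χ ⁻¹' {k}) with hy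
  have hp0 : 0 ≤ p := measureReal_nonneg
  have hq0 : 0 ≤ q := measureReal_nonneg
  have hy0 : 0 ≤ y := div_nonneg measureReal_nonneg measureReal_nonneg
  rw [ENNReal.ofReal_eq_zero, ← not_lt]
  have hk0 := InformationTheory.klFun_nonneg (div_nonneg (div_nonneg hq0 hp0) hy0)
  -- If `y = 0`, division by `y` carries no information; then `q = 0` because its set lies in a null
  -- set.
  rcases hy0.eq_or_lt with h0 | h0
  · have : q = 0 := by
      rcases div_eq_zero_iff.1 h0.symm with h | h
      · exact measureReal_mono_null (Set.inter_subset_inter_right _ Set.inter_subset_right) h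
      · exact measureReal_mono_null (Set.inter_subset_right.trans Set.inter_subset_right) h
    simp [this, ← h0]
  · constructor
    · intro h hpne
      have h1 : InformationTheory.klFun (q / p / y) = 0 := by
        by_contra hne
        exact h (mul_pos (lt_of_le_of_ne hp0 (Ne.symm hpne))
          (mul_pos h0 (lt_of_le_of_ne hk0 (Ne.symm hne))))
      rw [InformationTheory.klFun_eq_zero_iff (div_nonneg (div_nonneg hq0 hp0) hy0),
        div_eq_one_iff_eq h0.ne'] at h1
      exact h1
    · intro h
      by_cases hpz : p = 0
      · simp [hpz]
      · rw [h hpz, div_self h0.ne', InformationTheory.klFun_one]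
        simp

theorem measurableSet_pair_fiber {φ : X → ι} {ψ : X → κ}
    (hφ : ∀ i, MeasurableSet (φ ⁻¹' {i})) (hψ : ∀ j, MeasurableSet (ψ ⁻¹' {j})) (p : ι × κ) :
    MeasurableSet ((fun x => (φ x, ψ x)) ⁻¹' {p}) := by
  have hpre : (fun x => (φ x, ψ x)) ⁻¹' {p} = φ ⁻¹' {p.1} ∩ ψ ⁻¹' {p.2} := by
    ext x
    simp [Prod.ext_iff]
  exact hpre ▸ (hφ _).inter (hψ _)

/-- Submodularity of entropy. -/
theorem ent_submodular [IsProbabilityMeasure μ] [Countable ι] [Countable κ] {φ : X → ι}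
    {ψ : X → κ} {χ : X → l} (hφ : ∀ i, MeasurableSet (φ ⁻¹' {i}))
    (hψ : ∀ j, MeasurableSet (ψ ⁻¹' {j})) (hχ : ∀ k, MeasurableSet (χ ⁻¹' {k})) :
    ent μ (fun x => (φ x, ψ x, χ x)) + ent μ χ
        + condInfo μ φ ψ χ
      = ent μ (fun x => (φ x, χ x)) + ent μ (fun x => (ψ x, χ x)) := by
  rw [ent_pair (ψ := fun x => (ψ x, χ x)) hφ (measurableSet_pair_fiber hψ hχ),
    ent_pair hφ hχ, condEnt_eq_add_condInfo hφ hψ hχ]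
  ring

theorem ent_unit [IsProbabilityMeasure μ] : ent μ (fun _ : X => ()) = 0 := by
  simp [ent]

end RandomVariables

/-! ### Partitions as labelling maps. -/

namespace Partition

variable {X : Type*} [MeasurableSpace X] {μ : Measure X}

theorem exists_mem_atom (β : Partition X) (x : X) : ∃ A : β.atoms, x ∈ (A : Set X) := by
  obtain ⟨A, hA, hx⟩ : x ∈ ⋃₀ β.atoms := by rw [β.sUnion_eq]; trivial
  exact ⟨⟨A, hA⟩, hx⟩

/-- The atom of a partition that contains a given point. -/
noncomputable def label (β : Partition X) (x : X) : β.atoms := (β.exists_mem_atom x).choose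

theorem mem_label (β : Partition X) (x : X) : x ∈ (β.label x : Set X) :=
  (β.exists_mem_atom x).choose_spec

theorem label_eq_iff (β : Partition X) {x : X} {A : β.atoms} : β.label x = A ↔ x ∈ (A : Set X) := by
  constructor
  · rintro rfl
    exact β.mem_label x
  · intro hx
    by_contra hne
    exact Set.disjoint_left.1 (β.pairwiseDisjoint (β.label x).2 A.2
      fun h => hne (Subtype.ext h)) (β.mem_label x) hx

theorem label_preimage_singleton (β : Partition X) (A : β.atoms) : β.label ⁻¹' {A} = A := by
  ext x
  exact β.label_eq_iff

theorem measurableSet_label_fiber (β : Partition X) (A : β.atoms) :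
    MeasurableSet (β.label ⁻¹' {A}) := by
  rw [label_preimage_singleton]
  exact β.measurable A A.2

theorem label_eq_label_iff (β : Partition X) {x y : X} :
    β.label x = β.label y ↔ ∃ A ∈ β.atoms, x ∈ A ∧ y ∈ A := by
  constructor
  · intro h
    exact ⟨β.label y, (β.label y).2, h ▸ β.mem_label x, β.mem_label y⟩
  · rintro ⟨A, hA, hx, hy⟩
    rw [β.label_eq_iff.2 (show x ∈ ((⟨A, hA⟩ : β.atoms) : Set X) from hx),
      β.label_eq_iff.2 (show y ∈ ((⟨A, hA⟩ : β.atoms) : Set X) from hy)]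

theorem countable_atoms (β : Partition X) : Countable β.atoms := β.countable.to_subtype

theorem entropy_eq_ent (β : Partition X) : β.entropy μ = ent μ β.label := by
  simp only [entropy, ent, label_preimage_singleton]

theorem join_label_eq_iff (β γ : Partition X) {x y : X} :
    (β.join γ).label x = (β.join γ).label y ↔ β.label x = β.label y ∧ γ.label x = γ.label y := by
  rw [label_eq_label_iff, label_eq_label_iff, label_eq_label_iff]
  constructor
  · rintro ⟨_, ⟨A, hA, B, hB, rfl⟩, hx, hy⟩
    exact ⟨⟨A, hA, hx.1, hy.1⟩, ⟨B, hB, hx.2, hy.2⟩⟩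
  · rintro ⟨⟨A, hA, hx, hy⟩, ⟨B, hB, hx', hy'⟩⟩
    exact ⟨_, ⟨A, hA, B, hB, rfl⟩, ⟨hx, hx'⟩, ⟨hy, hy'⟩⟩

end Partition

/-! ### The joint entropy as an invariant submodular set function. -/

section Refinement

variable {G : Type*} [Monoid G] {X : Type*} [MeasurableSpace X] {μ : Measure X}

namespace Action

theorem map_mul_apply (T : Action G μ) (g h : G) (x : X) :
    T.map (g * h) x = T.map g (T.map h x) := by
  rw [map_mul]
  rfl

theorem map_one_apply (T : Action G μ) (x : X) : T.map 1 x = x := by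
  rw [map_one]
  rfl

theorem pullback_label_eq_iff (T : Action G μ) (g : G) (α : Partition X) {x y : X} :
    (T.pullback g α).label x = (T.pullback g α).label y ↔
      α.label (T.map g x) = α.label (T.map g y) := by
  rw [Partition.label_eq_label_iff, Partition.label_eq_label_iff]
  constructor
  · rintro ⟨_, ⟨A, hA, rfl⟩, hx, hy⟩
    exact ⟨A, hA, hx, hy⟩
  · rintro ⟨A, hA, hx, hy⟩
    exact ⟨_, ⟨A, hA, rfl⟩, hx, hy⟩

theorem refine_label_eq_iff (T : Action G μ) (α : Partition X) (Q : Set G) [Finite Q] {x y : X} :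
    (T.refine α Q).label x = (T.refine α Q).label y ↔
      ∀ q ∈ Q, α.label (T.map q x) = α.label (T.map q y) := by
  rw [Partition.label_eq_label_iff]
  constructor
  · rintro ⟨_, ⟨A, rfl⟩, hx, hy⟩ q hq
    rw [Set.mem_iInter] at hx hy
    rw [Partition.label_eq_label_iff]
    exact ⟨_, (A ⟨q, hq⟩).2, hx ⟨q, hq⟩, hy ⟨q, hq⟩⟩
  · intro h
    refine ⟨_, ⟨fun q => α.label (T.map (q : G) x), rfl⟩, ?_, ?_⟩
    · exact Set.mem_iInter.2 fun q => α.mem_label _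
    · refine Set.mem_iInter.2 fun q => ?_
      change T.map (q : G) y ∈ (α.label (T.map (q : G) x) : Set X)
      rw [h q q.2]
      exact α.mem_label _

theorem ent_comp_map (T : Action G μ) (g : G) (β : Partition X) :
    ent μ (fun x => β.label (T.map g x)) = β.entropy μ := by
  rw [β.entropy_eq_ent, ent, ent]
  refine tsum_congr fun A => ?_
  have h : (fun x => β.label (T.map g x)) ⁻¹' {A} = T.map g ⁻¹' (β.label ⁻¹' {A}) := rfl
  rw [h, Measure.real, Measure.real, (T.measurePreserving g).measure_preimage
    (β.measurableSet_label_fiber A).nullMeasurableSet]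

theorem entropy_refine_congr (T : Action G μ) (α : Partition X) {P Q : Set G} [Finite P]
    [Finite Q] (h : P = Q) : (T.refine α P).entropy μ = (T.refine α Q).entropy μ := by
  subst h
  rfl

theorem entropy_refine_singleton (T : Action G μ) (α : Partition X) (g : G) :
    (T.refine α {g}).entropy μ = α.entropy μ := by
  rw [← T.ent_comp_map g α, Partition.entropy_eq_ent]
  refine ent_congr fun x y => ?_
  simp [refine_label_eq_iff]

theorem entropy_refine_one (T : Action G μ) (α : Partition X) :
    (T.refine α {1}).entropy μ = α.entropy μ := T.entropy_refine_singleton α 1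

/-- `α^(Qg)` has the same fibres as `T_g⁻¹ α^Q`, and `T_g` preserves the measure. Invariance holds
for right translations only. -/
theorem entropy_refine_image_mul_right (T : Action G μ) (α : Partition X) (Q : Set G) [Finite Q]
    (g : G) : (T.refine α ((· * g) '' Q)).entropy μ = (T.refine α Q).entropy μ := by
  rw [← T.ent_comp_map g (T.refine α Q), Partition.entropy_eq_ent]
  refine ent_congr fun x y => ?_
  simp [refine_label_eq_iff, map_mul_apply]

theorem entropy_refine_join_pullback (T : Action G μ) (α : Partition X) (Q : Set G) [Finite Q]
    (g : G) : ((T.refine α Q).join (T.pullback g (T.refine α Q))).entropy μ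
      = (T.refine α (Q ∪ (· * g) '' Q : Set G)).entropy μ := by
  rw [Partition.entropy_eq_ent, Partition.entropy_eq_ent]
  refine ent_congr fun x y => ?_
  simp only [Partition.join_label_eq_iff, pullback_label_eq_iff, refine_label_eq_iff,
    Set.mem_union, or_imp, forall_and, Set.forall_mem_image, map_mul_apply]

theorem entropy_join_pullback (T : Action G μ) (α : Partition X) (g : G) :
    (α.join (T.pullback g α)).entropy μ = (T.refine α {1, g}).entropy μ := by
  rw [Partition.entropy_eq_ent, Partition.entropy_eq_ent]
  refine ent_congr fun x y => ?_
  simp [Partition.join_label_eq_iff, pullback_label_eq_iff, refine_label_eq_iff, map_one_apply]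

/-- The defect is the mutual information of `α^P` and `α^Q` given `α^(P ∩ Q)`. -/
theorem entropy_refine_union_add [IsProbabilityMeasure μ] (T : Action G μ) (α : Partition X)
    (P Q : Set G) [Finite P] [Finite Q] :
    (T.refine α (P ∪ Q : Set G)).entropy μ + (T.refine α (P ∩ Q : Set G)).entropy μ
      ≤ (T.refine α P).entropy μ + (T.refine α Q).entropy μ := by
  have : Countable (T.refine α P).atoms := Partition.countable_atoms _
  have : Countable (T.refine α Q).atoms := Partition.countable_atoms _
  have h := ent_submodular (μ := μ) (T.refine α P).measurableSet_label_fiber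
    (T.refine α Q).measurableSet_label_fiber (T.refine α (P ∩ Q : Set G)).measurableSet_label_fiber
  simp only [Partition.entropy_eq_ent]
  rw [ent_congr (φ := fun x => ((T.refine α P).label x, (T.refine α Q).label x,
      (T.refine α (P ∩ Q : Set G)).label x)) (ψ := (T.refine α (P ∪ Q : Set G)).label),
    ent_congr (φ := fun x => ((T.refine α P).label x, (T.refine α (P ∩ Q : Set G)).label x))
      (ψ := (T.refine α P).label),
    ent_congr (φ := fun x => ((T.refine α Q).label x, (T.refine α (P ∩ Q : Set G)).label x))
      (ψ := (T.refine α Q).label)] at h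
  · rw [← h]
    exact le_self_add
  all_goals
    intro x y
    simp only [Prod.mk.injEq, refine_label_eq_iff, Set.mem_union, Set.mem_inter_iff]
    grind

theorem entropy_refine_lt_top [IsProbabilityMeasure μ] (T : Action G μ) {α : Partition X}
    (hα : α.entropy μ < ∞) {Q : Set G} [Finite Q] : (T.refine α Q).entropy μ < ∞ := by
  have hQ : Q.Finite := Set.toFinite Q
  suffices h : ∀ Q : Set G, Q.Finite → ∀ [Finite Q], (T.refine α Q).entropy μ < ∞ from h Q hQ
  intro Q hQ
  induction Q, hQ using Set.Finite.induction_on with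
  | empty =>
    intro _
    rw [Partition.entropy_eq_ent, ent_congr (ψ := fun _ : X => ())
      (by simp [refine_label_eq_iff]), ent_unit]
    exact ENNReal.zero_lt_top
  | @insert g Q hg hQ ih =>
    intro _
    have : Finite Q := hQ
    have h := T.entropy_refine_union_add α {g} Q
    rw [T.entropy_refine_singleton] at h
    rw [T.entropy_refine_congr α (Set.insert_eq g Q)]
    exact (le_self_add.trans h).trans_lt (ENNReal.add_lt_top.2 ⟨hα, ih⟩)

/-- The entropy of `α^Q` as a real number. -/
noncomputable def finsetEntropy (T : Action G μ) (α : Partition X) (Q : Finset G) : ℝ :=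
  ((T.refine α (Q : Set G)).entropy μ).toReal

variable [DecidableEq G]

theorem finsetEntropy_submodular [IsProbabilityMeasure μ] (T : Action G μ) {α : Partition X}
    (hα : α.entropy μ < ∞) (P Q : Finset G) :
    T.finsetEntropy α (P ∪ Q) + T.finsetEntropy α (P ∩ Q)
      ≤ T.finsetEntropy α P + T.finsetEntropy α Q := by
  simp only [finsetEntropy]
  rw [← ENNReal.toReal_add, ← ENNReal.toReal_add]
  · refine ENNReal.toReal_mono (ENNReal.add_lt_top.2 ⟨T.entropy_refine_lt_top hα,
      T.entropy_refine_lt_top hα⟩).ne ?_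
    rw [T.entropy_refine_congr α (Finset.coe_union P Q),
      T.entropy_refine_congr α (Finset.coe_inter P Q)]
    exact T.entropy_refine_union_add α P Q
  all_goals exact (T.entropy_refine_lt_top hα).ne

theorem finsetEntropy_image_mul_right (T : Action G μ) (α : Partition X) (Q : Finset G) (g : G) :
    T.finsetEntropy α (Q.image (· * g)) = T.finsetEntropy α Q := by
  rw [finsetEntropy, finsetEntropy, T.entropy_refine_congr α Finset.coe_image,
    entropy_refine_image_mul_right]

theorem bigF_eq (T : Action G μ) {r : ℕ} (s : Fin r → G) (α : Partition X) :
    T.bigF s α = (1 - 2 * (r : ℝ)) * T.finsetEntropy α {1}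
      + ∑ i, T.finsetEntropy α ({1} ∪ ({1} : Finset G).image (· * s i)) := by
  simp only [bigF, finsetEntropy]
  congr 1
  · rw [T.entropy_refine_congr α (Finset.coe_singleton 1), entropy_refine_one]
  · refine Finset.sum_congr rfl fun i _ => ?_
    have h : ({1, s i} : Set G) = (({1} ∪ ({1} : Finset G).image (· * s i) : Finset G) : Set G) := by
      ext
      simp
    rw [entropy_join_pullback, T.entropy_refine_congr α h]

theorem bigF_refine_eq (T : Action G μ) {r : ℕ} (s : Fin r → G) (α : Partition X) (Q : Finset G)
    {Q' : Set G} [Finite Q'] (h : Q' = Q) :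
    T.bigF s (T.refine α Q') = (1 - 2 * (r : ℝ)) * T.finsetEntropy α Q
      + ∑ i, T.finsetEntropy α (Q ∪ Q.image (· * s i)) := by
  subst h
  simp only [bigF, finsetEntropy]
  congr 1
  refine Finset.sum_congr rfl fun i _ => ?_
  have h : (Q ∪ (· * s i) '' Q : Set G) = ((Q ∪ Q.image (· * s i) : Finset G) : Set G) := by
    ext
    simp
  rw [entropy_refine_join_pullback, T.entropy_refine_congr α h]

end Action

end Refinement

/-! ### Rooted Cayley trees and functions that are modular along them. -/

/-- A rooted tree structure on the left-Cayley graph of a monoid: every `g ≠ 1` is a letter times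
its parent, and multiplying by letters on the right is compatible with parents and lengths. -/
structure CayleyTree {G Λ : Type*} [Monoid G] (letter : Λ → G) where
  len : G → ℕ
  parent : G → G
  len_one : len 1 = 0
  parent_one : parent 1 = 1
  len_parent : ∀ g, g ≠ 1 → len (parent g) + 1 = len g
  exists_letter_mul_parent : ∀ g, g ≠ 1 → ∃ x, g = letter x * parent g
  letter_mul : ∀ x g, (letter x * g ≠ 1 ∧ parent (letter x * g) = g) ∨
    (g ≠ 1 ∧ parent g = letter x * g)
  len_mul_letter_le : ∀ g x, len (g * letter x) ≤ len g + 1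
  exists_mul_letter : ∀ g, g ≠ 1 → ∃ x a, g = a * letter x ∧ len a + 1 = len g
  letter_unique : ∀ a b x y, a * letter x = b * letter y → len a < len (a * letter x) →
    len b < len (a * letter x) → x = y
  parent_mul_letter : ∀ a x, a ≠ 1 → len a < len (a * letter x) →
    parent (a * letter x) = parent a * letter x

namespace CayleyTree

variable {G Λ : Type*} [Monoid G] {letter : Λ → G} (t : CayleyTree letter)

theorem len_parent_le (g : G) : t.len (t.parent g) ≤ t.len g := by
  by_cases h : g = 1
  · rw [h, t.parent_one]
  · have := t.len_parent g h
    omega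

theorem len_letter_mul_le (x : Λ) (g : G) : t.len (letter x * g) ≤ t.len g + 1 := by
  rcases t.letter_mul x g with ⟨h, h'⟩ | ⟨h, h'⟩
  · rw [← t.len_parent _ h, h']
  · have := t.len_parent g h
    rw [h'] at this
    omega

theorem eq_one_of_len_eq_zero {g : G} (h : t.len g = 0) : g = 1 := by
  by_contra hne
  have := t.len_parent g hne
  omega

theorem mem_ball_iff {n : ℕ} {g : G} : g ∈ ball (Set.range letter) n ↔ t.len g ≤ n := by
  constructor
  · rintro ⟨l, hl, rfl⟩
    refine le_trans ?_ hl
    clear hl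
    induction l with
    | nil => simp [t.len_one]
    | cons a l ih =>
      obtain ⟨_, x, rfl⟩ := a
      rw [List.map_cons, List.prod_cons, List.length_cons]
      exact (t.len_letter_mul_le x _).trans (Nat.succ_le_succ ih)
  · intro h
    induction n generalizing g with
    | zero =>
      rw [t.eq_one_of_len_eq_zero (Nat.le_zero.1 h)]
      exact ⟨[], le_rfl, rfl⟩
    | succ n ih =>
      by_cases hg : g = 1
      · exact ⟨[], Nat.zero_le _, by simp [hg]⟩
      · obtain ⟨x, hx⟩ := t.exists_letter_mul_parent g hg
        have hlen := t.len_parent g hg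
        obtain ⟨l, hl, hp⟩ := ih (g := t.parent g) (by omega)
        refine ⟨⟨letter x, x, rfl⟩ :: l, by simpa using hl, ?_⟩
        rw [List.map_cons, List.prod_cons, hp, ← hx]

/-- Adjacency in the tree. -/
def Adj (u v : G) : Prop := (u ≠ 1 ∧ t.parent u = v) ∨ (v ≠ 1 ∧ t.parent v = u)

noncomputable instance (u v : G) : Decidable (t.Adj u v) := Classical.dec _

theorem adj_iff {u v : G} : t.Adj u v ↔ ∃ x, u = letter x * v ∨ v = letter x * u := by
  constructor
  · rintro (⟨h, rfl⟩ | ⟨h, rfl⟩)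
    · obtain ⟨x, hx⟩ := t.exists_letter_mul_parent u h
      exact ⟨x, Or.inl hx⟩
    · obtain ⟨x, hx⟩ := t.exists_letter_mul_parent v h
      exact ⟨x, Or.inr hx⟩
  · rintro ⟨x, rfl | rfl⟩
    · exact t.letter_mul x v
    · exact (t.letter_mul x u).symm

theorem Adj.symm {u v : G} (h : t.Adj u v) : t.Adj v u := Or.symm h

theorem not_adj_self (u : G) : ¬ t.Adj u u := by
  rintro (⟨h, h'⟩ | ⟨h, h'⟩) <;>
  · have := t.len_parent u h
    rw [h'] at this
    omega

theorem adj_mul_right [IsRightCancelMul G] (u v g : G) : t.Adj (u * g) (v * g) ↔ t.Adj u v := by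
  simp only [adj_iff, ← mul_assoc, mul_left_inj]

/-- `d` is a descendant of `c`, or `c` itself. -/
def IsDesc (c d : G) : Prop := ∃ k : ℕ, t.parent^[k] d = c

theorem IsDesc.refl (c : G) : t.IsDesc c c := ⟨0, rfl⟩

variable {t}

theorem IsDesc.of_parent {c d : G} (h : t.IsDesc c (t.parent d)) : t.IsDesc c d := by
  obtain ⟨k, hk⟩ := h
  exact ⟨k + 1, hk⟩

theorem IsDesc.parent_of_ne {c d : G} (h : t.IsDesc c d) (hne : d ≠ c) :
    t.IsDesc c (t.parent d) := by
  obtain ⟨_ | k, hk⟩ := h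
  · exact absurd hk hne
  · exact ⟨k, hk⟩

theorem IsDesc.len_le {c d : G} (h : t.IsDesc c d) : t.len c ≤ t.len d := by
  obtain ⟨k, rfl⟩ := h
  induction k generalizing d with
  | zero => exact le_rfl
  | succ k ih => exact ih.trans (t.len_parent_le d)

theorem not_isDesc_parent {c : G} (hc : c ≠ 1) : ¬ t.IsDesc c (t.parent c) := by
  intro h
  have := h.len_le
  have := t.len_parent c hc
  omega

theorem parent_ne {c : G} (hc : c ≠ 1) : t.parent c ≠ c := fun h =>
  not_isDesc_parent hc ⟨0, h⟩

theorem not_isDesc_one {c : G} (hc : c ≠ 1) : ¬ t.IsDesc c 1 := by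
  intro h
  have h0 := h.len_le
  rw [t.len_one] at h0
  exact hc (t.eq_one_of_len_eq_zero (Nat.le_zero.1 h0))

variable (t)

/-- A set of vertices closed under taking parents. -/
def Closed (P : Finset G) : Prop := ∀ c ∈ P, t.parent c ∈ P

variable {t}

theorem Closed.not_isDesc {P : Finset G} (hP : t.Closed P) {c : G} (hc : c ∉ P) :
    ∀ d ∈ P, ¬ t.IsDesc c d := by
  rintro d hd ⟨k, rfl⟩
  apply hc
  clear hc
  induction k generalizing d with
  | zero => exact hd
  | succ k ih => exact ih _ (hP d hd)

variable [DecidableEq G]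

variable (t) in
/-- `P` is closed under parents and `Q \ P` is a union of branches attached to `Q ∩ P`. -/
def Attached (P Q : Finset G) : Prop :=
  t.Closed P ∧ ∀ c ∈ Q, c ∉ P → c ≠ 1 ∧ t.parent c ∈ Q

variable (t) in
/-- `Φ` grows by `h c` when a leaf `c` is added. -/
def LeafRule (Φ : Finset G → ℝ) (h : G → ℝ) : Prop :=
  ∀ c Q, c ≠ 1 → t.parent c ∈ Q → (∀ d ∈ Q, ¬ t.IsDesc c d) → Φ (insert c Q) = Φ Q + h c

variable (t) in
/-- Submodularity on attached pairs. -/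
def AttSubmodular (Φ : Finset G → ℝ) : Prop :=
  ∀ P Q, t.Attached P Q → Φ (P ∪ Q) + Φ (P ∩ Q) ≤ Φ P + Φ Q

/-- The vertices of `Q \ P` are removed from `Q` in order of decreasing length. The removed vertex
is a leaf both for `Q` and for `P ∪ Q`, so both values drop by the same amount, while `P ∩ Q` is
unchanged. -/
theorem LeafRule.modular {Φ : Finset G → ℝ} {h : G → ℝ} (hΦ : t.LeafRule Φ h) {P Q : Finset G}
    (hPQ : t.Attached P Q) : Φ (P ∪ Q) + Φ (P ∩ Q) = Φ P + Φ Q := by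
  induction hn : (Q \ P).card generalizing Q with
  | zero =>
    have hsub : Q ⊆ P := Finset.sdiff_eq_empty_iff_subset.1 (Finset.card_eq_zero.1 hn)
    rw [Finset.union_eq_left.2 hsub, Finset.inter_eq_right.2 hsub]
  | succ n ih =>
    have hne : (Q \ P).Nonempty := Finset.card_pos.1 (by omega)
    obtain ⟨c, hc, hmax⟩ := Finset.exists_max_image (Q \ P) t.len hne
    obtain ⟨hcQ, hcP⟩ := Finset.mem_sdiff.1 hc
    obtain ⟨hc1, hpc⟩ := hPQ.2 c hcQ hcP
    have hdesc : ∀ d ∈ Q.erase c, ¬ t.IsDesc c d := by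
      intro d hd h
      obtain ⟨hdc, hdQ⟩ := Finset.mem_erase.1 hd
      by_cases hdP : d ∈ P
      · exact hPQ.1.not_isDesc hcP d hdP h
      · have h1 := hmax d (Finset.mem_sdiff.2 ⟨hdQ, hdP⟩)
        have h2 := (h.parent_of_ne hdc).len_le
        have h3 := t.len_parent d (hPQ.2 d hdQ hdP).1
        omega
    have hpc' : t.parent c ∈ Q.erase c := Finset.mem_erase.2 ⟨parent_ne hc1, hpc⟩
    have hatt : t.Attached P (Q.erase c) := by
      refine ⟨hPQ.1, fun d hd hdP => ?_⟩
      have h2 := hPQ.2 d (Finset.mem_of_mem_erase hd) hdP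
      refine ⟨h2.1, Finset.mem_erase.2 ⟨fun h => hdesc d hd ⟨1, h⟩, h2.2⟩⟩
    have hcard : (Q.erase c \ P).card = n := by
      rw [Finset.erase_sdiff_comm, Finset.card_erase_of_mem hc, hn]
      rfl
    have h1 := ih hatt hcard
    have h2 := hΦ c (Q.erase c) hc1 hpc' hdesc
    have h3 := hΦ c (P ∪ Q.erase c) hc1 (Finset.mem_union_right _ hpc') fun d hd =>
      (Finset.mem_union.1 hd).elim (hPQ.1.not_isDesc hcP d) (hdesc d)
    have e1 : insert c (Q.erase c) = Q := Finset.insert_erase hcQ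
    have e2 : insert c (P ∪ Q.erase c) = P ∪ Q := by
      rw [← Finset.union_insert, e1]
    have e3 : P ∩ Q.erase c = P ∩ Q := by
      ext d
      simp only [Finset.mem_inter, Finset.mem_erase]
      grind
    rw [e1] at h2
    rw [e2] at h3
    rw [e3] at h1
    linarith

/-! ### The two submodularity inequalities along balls. -/

section Balls

variable {B : ℕ → Finset G} (hB : ∀ n g, g ∈ B n ↔ t.len g ≤ n)

include hB

omit [DecidableEq G] in
theorem closed_ball (n : ℕ) : t.Closed (B n) := fun c hc =>
  (hB n _).2 ((t.len_parent_le c).trans ((hB n c).1 hc))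

theorem parent_mem_ball {n : ℕ} {c : G} (hc : t.len c ≤ n + 1) : t.parent c ∈ B n := by
  rw [hB]
  by_cases h : c = 1
  · rw [h, t.parent_one, t.len_one]
    exact Nat.zero_le n
  · have := t.len_parent c h
    omega

theorem len_le_of_mem_image {n : ℕ} {x : Λ} {c : G} (hc : c ∈ (B n).image (· * letter x)) :
    t.len c ≤ n + 1 := by
  obtain ⟨a, ha, rfl⟩ := Finset.mem_image.1 hc
  exact (t.len_mul_letter_le a x).trans (Nat.succ_le_succ ((hB n a).1 ha))

theorem closed_of_ball_subset {n : ℕ} {P : Finset G} (h1 : B n ⊆ P) (h2 : P ⊆ B (n + 1)) :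
    t.Closed P := fun c hc => h1 (parent_mem_ball hB ((hB _ c).1 (h2 hc)))

theorem union_image_subset (n : ℕ) (x : Λ) : B n ∪ (B n).image (· * letter x) ⊆ B (n + 1) := by
  refine Finset.union_subset (fun c hc => ?_) fun c hc => (hB _ c).2 (len_le_of_mem_image hB hc)
  have := (hB n c).1 hc
  exact (hB _ c).2 (by omega)

theorem closed_union_image (n : ℕ) (x : Λ) : t.Closed (B n ∪ (B n).image (· * letter x)) :=
  closed_of_ball_subset hB Finset.subset_union_left (union_image_subset hB n x)

/-- If `a * letter x` leaves the ball, then `a` has the maximal length `n + 1 > 0` and no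
cancellation occurs, so taking parents commutes with the translation. Radius `0` fails: the parent
of `letter x` is `1`, which is not in the translate of `{1}`. -/
theorem attached_image (n : ℕ) (x : Λ) :
    t.Attached (B (n + 1)) ((B (n + 1)).image (· * letter x)) := by
  refine ⟨closed_ball hB _, fun c hc hcB => ?_⟩
  obtain ⟨a, ha, rfl⟩ := Finset.mem_image.1 hc
  rw [hB] at ha hcB
  have hle := t.len_mul_letter_le a x
  have ha1 : a ≠ 1 := by
    rintro rfl
    rw [t.len_one] at hle
    omega
  refine ⟨fun h => ?_, ?_⟩
  · rw [h, t.len_one] at hcB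
    omega
  · rw [t.parent_mul_letter a x ha1 (by omega)]
    refine Finset.mem_image_of_mem _ ((hB _ _).2 ((t.len_parent_le a).trans ha))

theorem AttSubmodular.union_image_le [IsRightCancelMul G] {Φ : Finset G → ℝ}
    (hΦ : t.AttSubmodular Φ)
    (hinv : ∀ Q g, Φ (Q.image (· * g)) = Φ Q) (n : ℕ) (x : Λ) :
    Φ (B (n + 1) ∪ (B (n + 1)).image (· * letter x))
      + Φ (B (n + 1) ∩ (B (n + 1)).image (· * letter x)) ≤ 2 * Φ (B (n + 1)) := by
  have := hΦ _ _ (attached_image hB n x)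
  rw [hinv] at this
  linarith

/-- The letters are adjoined one at a time. A word outside `B n` lying in both `(B n)x` and `(B n)y`
has last letter both `x` and `y`, so each new set meets the previous union in `B n` alone. -/
theorem AttSubmodular.partial_ball_le {Φ : Finset G → ℝ} (hΦ : t.AttSubmodular Φ) (n : ℕ)
    [DecidableEq Λ] (A : Finset Λ) :
    Φ (B n ∪ A.biUnion fun x => B n ∪ (B n).image (· * letter x)) + A.card * Φ (B n)
      ≤ Φ (B n) + ∑ x ∈ A, Φ (B n ∪ (B n).image (· * letter x)) := by
  induction A using Finset.induction_on with
  | empty => simp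
  | insert x A hx ih =>
    set P := B n ∪ A.biUnion fun x => B n ∪ (B n).image (· * letter x) with hP
    set Q := B n ∪ (B n).image (· * letter x) with hQ
    have hPsub : P ⊆ B (n + 1) := by
      refine Finset.union_subset (Finset.subset_union_left.trans (union_image_subset hB n x)) ?_
      exact Finset.biUnion_subset.2 fun y _ => union_image_subset hB n y
    have hatt : t.Attached P Q := by
      refine ⟨closed_of_ball_subset hB Finset.subset_union_left hPsub, fun c hc hcP => ⟨?_, ?_⟩⟩
      · rintro rfl
        exact hcP (Finset.mem_union_left _ ((hB _ _).2 (by rw [t.len_one]; exact Nat.zero_le n)))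
      · exact closed_union_image hB n x c hc
    have hinter : P ∩ Q = B n := by
      refine Finset.Subset.antisymm (fun c hc => ?_)
        (Finset.subset_inter Finset.subset_union_left Finset.subset_union_left)
      obtain ⟨hcP, hcQ⟩ := Finset.mem_inter.1 hc
      by_contra hcB
      have hcQ' := (Finset.mem_union.1 hcQ).resolve_left hcB
      obtain ⟨y, hy, hcy⟩ := Finset.mem_biUnion.1 ((Finset.mem_union.1 hcP).resolve_left hcB)
      have hcy' := (Finset.mem_union.1 hcy).resolve_left hcB
      obtain ⟨a, ha, rfl⟩ := Finset.mem_image.1 hcQ'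
      obtain ⟨b, hb, hab⟩ := Finset.mem_image.1 hcy'
      rw [hB] at ha hb hcB
      have : x = y := t.letter_unique a b x y hab.symm (by omega) (by omega)
      exact hx (this ▸ hy)
    have hunion : (B n ∪ (insert x A).biUnion fun x => B n ∪ (B n).image (· * letter x))
        = P ∪ Q := by
      rw [Finset.biUnion_insert, hP, hQ]
      ext c
      simp only [Finset.mem_union]
      tauto
    have h := hΦ P Q hatt
    rw [hinter] at h
    rw [hunion, Finset.card_insert_of_notMem hx, Finset.sum_insert hx]
    push_cast
    linarith

/-- Stripping its last letter puts any nontrivial word of `B (n + 1)` into some `(B n)x`, so the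
partial union over all letters is the whole ball. -/
theorem AttSubmodular.ball_succ_le [Fintype Λ] {Φ : Finset G → ℝ} (hΦ : t.AttSubmodular Φ)
    (n : ℕ) : Φ (B (n + 1)) + Fintype.card Λ * Φ (B n)
      ≤ Φ (B n) + ∑ x, Φ (B n ∪ (B n).image (· * letter x)) := by
  classical
  have h := hΦ.partial_ball_le hB n Finset.univ
  have e : B (n + 1) = B n ∪ Finset.univ.biUnion fun x => B n ∪ (B n).image (· * letter x) := by
    refine Finset.Subset.antisymm (fun c hc => ?_) ?_
    · by_cases h1 : c = 1
      · exact Finset.mem_union_left _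
          ((hB _ _).2 (by rw [h1, t.len_one]; exact Nat.zero_le n))
      · obtain ⟨x, a, rfl, ha⟩ := t.exists_mul_letter c h1
        rw [hB] at hc
        exact Finset.mem_union_right _ (Finset.mem_biUnion.2 ⟨x, Finset.mem_univ x,
          Finset.mem_union_right _ (Finset.mem_image_of_mem _ ((hB _ _).2 (by omega)))⟩)
    · refine Finset.union_subset (fun c hc => ?_)
        (Finset.biUnion_subset.2 fun y _ => union_image_subset hB n y)
      have := (hB n c).1 hc
      exact (hB _ c).2 (by omega)
  rwa [← e, Finset.card_univ] at h

end Balls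

/-! ### Comparison of the joint entropy with the entropy of a Markov process. -/

section Entropy

variable (t) (H : Finset G → ℝ)

/-- The Markov property in terms of the joint entropies. -/
def EntropyMarkov : Prop :=
  ∀ c P, c ≠ 1 → t.parent c ∈ P → (∀ d ∈ P, ¬ t.IsDesc c d) →
    H (insert c P) + H {t.parent c} = H P + H {t.parent c, c}

/-- The joint entropy that a Markov process with the same two-point marginals would have. -/
noncomputable def markovEntropy (Q : Finset G) : ℝ :=
  H {1} + (∑ u ∈ Q, ∑ v ∈ Q, if t.Adj u v then H {u, v} - H {1} else 0) / 2

/-- The entropy increment of a leaf of a Markov process. -/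
noncomputable def leafEntropy (c : G) : ℝ := H {t.parent c, c} - H {1}

variable {t H}

/-- The new vertex has exactly one neighbour in `Q`, its parent. The double sum meets that edge in
both orders, whence the division by two. -/
theorem markovEntropy_leafRule : t.LeafRule (t.markovEntropy H) (t.leafEntropy H) := by
  intro c Q hc hp hd
  have hcQ : c ∉ Q := fun h => hd c h (IsDesc.refl t c)
  have hadj : ∀ v ∈ Q, t.Adj c v ↔ v = t.parent c := by
    intro v hv
    constructor
    · rintro (⟨-, h⟩ | ⟨-, h⟩)
      · exact h.symm
      · exact absurd ⟨1, h⟩ (hd v hv)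
    · rintro rfl
      exact Or.inl ⟨hc, rfl⟩
  have h1 : ∑ v ∈ Q, (if t.Adj c v then H {c, v} - H {1} else 0) = t.leafEntropy H c := by
    rw [Finset.sum_congr rfl fun v hv => by rw [if_congr (hadj v hv) rfl rfl],
      Finset.sum_ite_eq_of_mem' _ _ _ hp, leafEntropy, Finset.pair_comm]
  have h2 : ∑ v ∈ Q, (if t.Adj v c then H {v, c} - H {1} else 0) = t.leafEntropy H c := by
    rw [← h1]
    refine Finset.sum_congr rfl fun v _ => ?_
    rw [Finset.pair_comm]
    exact if_congr ⟨Adj.symm t, Adj.symm t⟩ rfl rfl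
  simp only [markovEntropy]
  rw [Finset.sum_insert hcQ, Finset.sum_insert hcQ, if_neg (t.not_adj_self c), h1,
    Finset.sum_congr rfl fun u _ => Finset.sum_insert hcQ, Finset.sum_add_distrib, h2]
  ring

variable (hinv : ∀ Q g, H (Q.image (· * g)) = H Q)

include hinv

theorem apply_singleton (g : G) : H {g} = H {1} := by
  have := hinv {1} g
  simpa using this

theorem markovEntropy_image [IsRightCancelMul G] (Q : Finset G) (g : G) :
    t.markovEntropy H (Q.image (· * g)) = t.markovEntropy H Q := by
  have hinj : Set.InjOn (· * g) (Q : Set G) := (mul_left_injective g).injOn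
  simp only [markovEntropy]
  rw [Finset.sum_image hinj, Finset.sum_congr rfl fun u _ => Finset.sum_image hinj]
  congr 2
  refine Finset.sum_congr rfl fun u _ => Finset.sum_congr rfl fun v _ => ?_
  refine if_congr (t.adj_mul_right u v g) ?_ rfl
  have := hinv {u, v} g
  rw [Finset.image_insert, Finset.image_singleton] at this
  rw [this]

theorem EntropyMarkov.leafRule (h : t.EntropyMarkov H) : t.LeafRule H (t.leafEntropy H) := by
  intro c Q hc hp hd
  have := h c Q hc hp hd
  rw [apply_singleton hinv] at this
  rw [leafEntropy]
  linarith

variable (hsub : ∀ P Q, H (P ∪ Q) + H (P ∩ Q) ≤ H P + H Q)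

include hsub

/-- Submodularity for `Q` and the edge from `c` to its parent: the increment of `H` at a leaf never
exceeds the Markov increment. -/
theorem insert_le {c : G} {Q : Finset G} (hp : t.parent c ∈ Q) (hc : c ∉ Q) :
    H (insert c Q) ≤ H Q + t.leafEntropy H c := by
  have h := hsub Q {t.parent c, c}
  have e1 : Q ∪ {t.parent c, c} = insert c Q := by
    ext d
    simp only [Finset.mem_union, Finset.mem_insert, Finset.mem_singleton]
    grind
  have e2 : Q ∩ {t.parent c, c} = {t.parent c} := by
    ext d
    simp only [Finset.mem_inter, Finset.mem_insert, Finset.mem_singleton]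
    grind
  rw [e1, e2, apply_singleton hinv] at h
  rw [leafEntropy]
  linarith

/-- When a subtree grows by one leaf, `M` gains exactly the leaf entropy and `H` at most that, so `M
- H` cannot decrease. The induction peels off a longest vertex of `Q \ P`. -/
theorem sub_le_sub_of_closed {P Q : Finset G} (hP : t.Closed P) (hQ : t.Closed Q) (h1 : 1 ∈ P)
    (hPQ : P ⊆ Q) : t.markovEntropy H P - H P ≤ t.markovEntropy H Q - H Q := by
  induction hn : (Q \ P).card generalizing Q with
  | zero =>
    have hsub : Q ⊆ P := Finset.sdiff_eq_empty_iff_subset.1 (Finset.card_eq_zero.1 hn)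
    rw [Finset.Subset.antisymm hPQ hsub]
  | succ n ih =>
    have hne : (Q \ P).Nonempty := Finset.card_pos.1 (by omega)
    obtain ⟨c, hc, hmax⟩ := Finset.exists_max_image (Q \ P) t.len hne
    obtain ⟨hcQ, hcP⟩ := Finset.mem_sdiff.1 hc
    have hc1 : c ≠ 1 := fun h => hcP (h ▸ h1)
    have hdesc : ∀ d ∈ Q.erase c, ¬ t.IsDesc c d := by
      intro d hd h
      obtain ⟨hdc, hdQ⟩ := Finset.mem_erase.1 hd
      by_cases hdP : d ∈ P
      · exact hP.not_isDesc hcP d hdP h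
      · have h1 := hmax d (Finset.mem_sdiff.2 ⟨hdQ, hdP⟩)
        have h2 := (h.parent_of_ne hdc).len_le
        have h3 := t.len_parent d (fun h' => hdP (h' ▸ ‹1 ∈ P›))
        omega
    have hclosed : t.Closed (Q.erase c) := fun d hd =>
      Finset.mem_erase.2 ⟨fun h => hdesc d hd ⟨1, h⟩, hQ d (Finset.mem_of_mem_erase hd)⟩
    have hpc' : t.parent c ∈ Q.erase c := Finset.mem_erase.2 ⟨parent_ne hc1, hQ c hcQ⟩
    have hcard : (Q.erase c \ P).card = n := by
      rw [Finset.erase_sdiff_comm, Finset.card_erase_of_mem hc, hn]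
      rfl
    have hsubset : P ⊆ Q.erase c := fun d hd =>
      Finset.mem_erase.2 ⟨fun h => hcP (h ▸ hd), hPQ hd⟩
    have h1 := ih hclosed hsubset hcard
    have h2 := markovEntropy_leafRule (H := H) c (Q.erase c) hc1 hpc' hdesc
    have h3 := insert_le hinv hsub hpc' (Finset.notMem_erase c Q)
    rw [Finset.insert_erase hcQ] at h2 h3
    linarith

omit hinv hsub in
theorem markovEntropy_one : t.markovEntropy H {1} = H {1} := by
  simp [markovEntropy, t.not_adj_self]

theorem sub_nonneg_of_closed {Q : Finset G} (hQ : t.Closed Q) (h1 : 1 ∈ Q) :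
    0 ≤ t.markovEntropy H Q - H Q := by
  have hone : t.Closed {1} := by
    intro c hc
    rw [Finset.mem_singleton] at hc
    simp [hc, t.parent_one]
  have := sub_le_sub_of_closed hinv hsub hone hQ (Finset.mem_singleton_self 1)
    (Finset.singleton_subset_iff.2 h1)
  rwa [markovEntropy_one, sub_self] at this

variable {B : ℕ → Finset G} (hB : ∀ n g, g ∈ B n ↔ t.len g ≤ n)

include hB

/-- By monotonicity `M = H` on every subtree between `{1}` and a ball. This gives the leaf identity
for subtrees `Q`; submodularity passes it from a large `Q` down to an arbitrary `P ⊆ Q`, since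
increments can only grow when the set shrinks. -/
theorem entropyMarkov_of_ball_eq (h : ∀ n, t.markovEntropy H (B n) - H (B n) = 0) :
    t.EntropyMarkov H := by
  intro c P hc hp hd
  obtain ⟨N, hN⟩ : ∃ N, insert c P ⊆ B N :=
    ⟨(insert c P).sup t.len, fun g hg => (hB _ _).2 (Finset.le_sup hg)⟩
  classical
  -- The largest subtree of the ball to which `c` can still be attached as a leaf.
  set Q := (B N).filter fun d => ¬ t.IsDesc c d with hQ
  have hcQ : c ∉ Q := fun h => (Finset.mem_filter.1 h).2 (IsDesc.refl t c)
  have hPQ : P ⊆ Q := fun d hdP =>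
    Finset.mem_filter.2 ⟨hN (Finset.mem_insert_of_mem hdP), hd d hdP⟩
  have hQN : Q ⊆ B N := Finset.filter_subset _ _
  have hQclosed : t.Closed Q := by
    intro d hdQ
    obtain ⟨h1, h2⟩ := Finset.mem_filter.1 hdQ
    exact Finset.mem_filter.2 ⟨closed_ball hB N d h1, fun h => h2 h.of_parent⟩
  have hQ1 : 1 ∈ Q := Finset.mem_filter.2
    ⟨(hB _ _).2 (by rw [t.len_one]; exact Nat.zero_le N), not_isDesc_one hc⟩
  have hcQclosed : t.Closed (insert c Q) := by
    intro d hdQ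
    rcases Finset.mem_insert.1 hdQ with rfl | hdQ
    · exact Finset.mem_insert_of_mem (hPQ hp)
    · exact Finset.mem_insert_of_mem (hQclosed d hdQ)
  have hcQN : insert c Q ⊆ B N :=
    Finset.insert_subset (hN (Finset.mem_insert_self c P)) hQN
  have d1 := sub_nonneg_of_closed hinv hsub hQclosed hQ1
  have d2 := sub_le_sub_of_closed hinv hsub hQclosed hcQclosed hQ1 (Finset.subset_insert c Q)
  have d3 := sub_le_sub_of_closed hinv hsub hcQclosed (closed_ball hB N)
    (Finset.mem_insert_of_mem hQ1) hcQN
  rw [h N] at d3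
  have hleaf := markovEntropy_leafRule (H := H) c Q hc (hPQ hp) (hQclosed.not_isDesc hcQ)
  have hle := insert_le hinv hsub hp fun h => hcQ (hPQ h)
  have hs := hsub (insert c P) Q
  have e1 : insert c P ∪ Q = insert c Q := by
    rw [Finset.insert_union, Finset.union_eq_right.2 hPQ]
  have e2 : insert c P ∩ Q = P := by
    rw [Finset.insert_inter_of_notMem hcQ, Finset.inter_eq_left.2 hPQ]
  rw [e1, e2] at hs
  have h1 := apply_singleton hinv (t.parent c)
  rw [leafEntropy] at hle hleaf
  linarith

/-- The first two hypotheses reverse the submodularity inequalities. The third supplies `M ≥ H` on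
the intersection; it is a hypothesis because that set need not contain the root, and the two kinds
of `G` obtain it differently. -/
theorem entropyMarkov_of_eq [Fintype Λ] [IsRightCancelMul G]
    (hball : ∀ n, H (B n) + ∑ x, H (B n ∪ (B n).image (· * letter x))
      ≤ H (B (n + 1)) + Fintype.card Λ * H (B n))
    (hunion : ∀ n x, 2 * H (B (n + 1)) ≤ H (B (n + 1) ∪ (B (n + 1)).image (· * letter x))
      + H (B (n + 1) ∩ (B (n + 1)).image (· * letter x)))
    (hinter : ∀ n x, (∀ m ≤ n, t.markovEntropy H (B m) - H (B m) = 0) →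
      0 ≤ t.markovEntropy H (B (n + 1) ∩ (B (n + 1)).image (· * letter x))
        - H (B (n + 1) ∩ (B (n + 1)).image (· * letter x))) : t.EntropyMarkov H := by
  have hM : t.AttSubmodular (t.markovEntropy H) := fun P Q h =>
    (markovEntropy_leafRule.modular h).le
  have hM' : t.AttSubmodular (fun Q => -t.markovEntropy H Q) := fun P Q h => by
    have := (markovEntropy_leafRule (H := H)).modular h
    linarith
  have hone : ∀ n, 1 ∈ B n := fun n => (hB _ _).2 (by rw [t.len_one]; exact Nat.zero_le n)
  have hzero : B 0 = {1} := by
    ext g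
    rw [hB, Finset.mem_singleton]
    exact ⟨fun h => t.eq_one_of_len_eq_zero (Nat.le_zero.1 h), fun h => by rw [h, t.len_one]⟩
  have key : ∀ n, (∀ m ≤ n, t.markovEntropy H (B m) - H (B m) = 0) ∧
      ∀ x, t.markovEntropy H (B n ∪ (B n).image (· * letter x))
        - H (B n ∪ (B n).image (· * letter x)) = 0 := by
    intro n
    induction n with
    | zero =>
      refine ⟨fun m hm => ?_, fun x => ?_⟩
      · rw [Nat.le_zero.1 hm, hzero, markovEntropy_one, sub_self]
      · have hx := t.letter_mul x 1
        rw [mul_one] at hx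
        obtain ⟨hx1, hx2⟩ := hx.resolve_right fun h => h.1 rfl
        have h := markovEntropy_leafRule (t := t) (H := H) (letter x) {1} hx1 (by simp [hx2]) (by
          intro d hd
          rw [Finset.mem_singleton] at hd
          rw [hd]
          exact not_isDesc_one hx1)
        have e : B 0 ∪ (B 0).image (· * letter x) = insert (letter x) {1} := by
          rw [hzero]
          ext
          simp [or_comm]
        rw [e, h, markovEntropy_one, leafEntropy, hx2, Finset.pair_comm]
        ring
    | succ n ih =>
      -- `M` and `H` agree on all the sets that bound the next ball, so the bound for `M` and the
      -- reversed bound for `H` give `M ≤ H` there; the other inequality is general.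
      have hBn : t.markovEntropy H (B (n + 1)) - H (B (n + 1)) = 0 := by
        have h1 := hM.ball_succ_le hB n
        have h2 := hball n
        have h3 : ∑ x, t.markovEntropy H (B n ∪ (B n).image (· * letter x))
            = ∑ x, H (B n ∪ (B n).image (· * letter x)) :=
          Finset.sum_congr rfl fun x _ => sub_eq_zero.1 (ih.2 x)
        have h4 := sub_eq_zero.1 (ih.1 n le_rfl)
        have h5 := sub_nonneg_of_closed hinv hsub (closed_ball hB (n + 1)) (hone _)
        rw [h3, h4] at h1
        linarith
      refine ⟨fun m hm => ?_, fun x => ?_⟩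
      · rcases Nat.le_succ_iff.1 hm with h | rfl
        · exact ih.1 m h
        · exact hBn
      -- The defects `M - H` of the union and of the intersection add up to at most twice that of
      -- the ball, which is zero; both are nonnegative, so both vanish.
      · have h1 := hM.union_image_le hB (markovEntropy_image hinv) n x
        have h2 := hunion n x
        have h3 := hinter n x ih.1
        have h4 := sub_nonneg_of_closed hinv hsub (closed_union_image hB (n + 1) x)
          (Finset.mem_union_left _ (hone _))
        linarith
  exact entropyMarkov_of_ball_eq hinv hsub hB fun n => (key n).1 n le_rfl

-- A Markov `H` is modular on attached pairs, so `-H` is submodular there as well, and the two ball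
-- inequalities for `-H` are the reversed ones for `H`.
omit hsub in
theorem EntropyMarkov.eq [Fintype Λ] [IsRightCancelMul G] (h : t.EntropyMarkov H) :
    (∀ n, H (B n) + ∑ x, H (B n ∪ (B n).image (· * letter x))
      ≤ H (B (n + 1)) + Fintype.card Λ * H (B n)) ∧
    (∀ n x, 2 * H (B (n + 1)) ≤ H (B (n + 1) ∪ (B (n + 1)).image (· * letter x))
      + H (B (n + 1) ∩ (B (n + 1)).image (· * letter x))) := by
  have hneg : t.AttSubmodular (fun Q => -H Q) := fun P Q hPQ => by
    have := (h.leafRule hinv).modular hPQ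
    linarith
  refine ⟨fun n => ?_, fun n x => ?_⟩
  · have := hneg.ball_succ_le hB n
    simp only [Finset.sum_neg_distrib] at this
    linarith
  · have := hneg.union_image_le hB (fun Q g => by rw [hinv]) n x
    linarith

end Entropy

end CayleyTree

/-! ### The Cayley trees of the free semigroup and the free group. -/

/-- The tree of words, ordered by deletion of the leftmost letter. -/
def freeMonoidTree (Λ : Type*) : CayleyTree (FreeMonoid.of : Λ → FreeMonoid Λ) where
  len g := g.toList.length
  parent g := FreeMonoid.ofList g.toList.tail
  len_one := rfl
  parent_one := rfl
  len_parent g hg := by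
    cases g using FreeMonoid.casesOn with
    | one => exact absurd rfl hg
    | of_mul x g => rfl
  exists_letter_mul_parent g hg := by
    cases g using FreeMonoid.casesOn with
    | one => exact absurd rfl hg
    | of_mul x g => exact ⟨x, rfl⟩
  letter_mul x g := Or.inl ⟨fun h => List.cons_ne_nil x g.toList h, rfl⟩
  len_mul_letter_le g x := by
    simp [FreeMonoid.toList_mul]
  exists_mul_letter g hg := by
    obtain h | ⟨l, x, h⟩ := g.toList.eq_nil_or_concat'
    · exact absurd h hg
    · refine ⟨x, FreeMonoid.ofList l, ?_, ?_⟩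
      · apply FreeMonoid.toList.injective
        rw [h]
        rfl
      · rw [h]
        simp
  letter_unique a b x y h _ _ := by
    have h' := congrArg FreeMonoid.toList h
    rw [FreeMonoid.toList_mul, FreeMonoid.toList_mul, FreeMonoid.toList_of,
      FreeMonoid.toList_of] at h'
    simpa using (List.append_inj' h' rfl).2
  parent_mul_letter a x ha _ := by
    cases a using FreeMonoid.casesOn with
    | one => exact absurd rfl ha
    | of_mul y a => rfl

section FreeGroup

variable {Λ : Type*} [DecidableEq Λ]

theorem toWord_mk_mul (p : Λ × Bool) (g : FreeGroup Λ) :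
    ((FreeGroup.mk [p] * g).toWord = p :: g.toWord) ∨
      (g.toWord = (p.1, !p.2) :: (FreeGroup.mk [p] * g).toWord) := by
  have h : (FreeGroup.mk [p] * g).toWord = FreeGroup.reduce (p :: g.toWord) := by
    conv_lhs => rw [← FreeGroup.mk_toWord (x := g), FreeGroup.mul_mk, FreeGroup.toWord_mk]
    rfl
  rw [h, FreeGroup.reduce.cons, FreeGroup.reduce_toWord]
  rcases hw : g.toWord with _ | ⟨q, L⟩
  · exact Or.inl rfl
  · dsimp only
    split_ifs with hq
    · right
      obtain ⟨q1, q2⟩ := q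
      obtain ⟨p1, p2⟩ := p
      simp only at hq
      simp [hq]
    · exact Or.inl rfl

/-- Reduction only deletes letters, so the reduced word is a sublist of `g.toWord ++ [p]`; the
growth of the norm leaves no room for a deletion. -/
theorem toWord_mul_mk_of_norm_lt {g : FreeGroup Λ} {p : Λ × Bool}
    (h : g.norm < (g * FreeGroup.mk [p]).norm) :
    (g * FreeGroup.mk [p]).toWord = g.toWord ++ [p] := by
  have e : g * FreeGroup.mk [p] = FreeGroup.mk (g.toWord ++ [p]) := by
    conv_lhs => rw [← FreeGroup.mk_toWord (x := g), FreeGroup.mul_mk]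
  have hsub : (g * FreeGroup.mk [p]).toWord.Sublist (g.toWord ++ [p]) := by
    rw [e, FreeGroup.toWord_mk]
    exact FreeGroup.reduce.red.sublist
  refine hsub.eq_of_length_le ?_
  rw [List.length_append]
  exact h

theorem toWord_mk_of_infix {g : FreeGroup Λ} {L : List (Λ × Bool)} (h : L <:+: g.toWord) :
    (FreeGroup.mk L).toWord = L := by
  rw [FreeGroup.toWord_mk]
  exact ((FreeGroup.isReduced_toWord (x := g)).infix h).reduce_eq

theorem toWord_mk_tail (g : FreeGroup Λ) :
    (FreeGroup.mk g.toWord.tail).toWord = g.toWord.tail :=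
  toWord_mk_of_infix (List.tail_suffix _).isInfix

/-- The tree of reduced words, ordered by deletion of the leftmost letter. -/
def freeGroupTree (Λ : Type*) [DecidableEq Λ] :
    CayleyTree (fun p : Λ × Bool => FreeGroup.mk [p]) where
  len g := g.norm
  parent g := FreeGroup.mk g.toWord.tail
  len_one := FreeGroup.norm_one
  parent_one := by simp [FreeGroup.one_eq_mk]
  len_parent g hg := by
    rw [FreeGroup.norm, FreeGroup.norm, toWord_mk_tail, List.length_tail]
    have : g.toWord.length ≠ 0 := fun h => hg (FreeGroup.norm_eq_zero.1 h)
    omega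
  exists_letter_mul_parent g hg := by
    rcases hw : g.toWord with _ | ⟨p, L⟩
    · exact absurd (FreeGroup.toWord_eq_nil_iff.1 hw) hg
    · refine ⟨p, ?_⟩
      rw [List.tail_cons, FreeGroup.mul_mk]
      conv_lhs => rw [← FreeGroup.mk_toWord (x := g), hw]
      rfl
  letter_mul p g := by
    rcases toWord_mk_mul p g with h | h
    · left
      refine ⟨fun h1 => ?_, ?_⟩
      · rw [h1, FreeGroup.toWord_one] at h
        exact List.cons_ne_nil _ _ h.symm
      · rw [h, List.tail_cons, FreeGroup.mk_toWord]
    · right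
      refine ⟨fun h1 => ?_, ?_⟩
      · rw [h1, FreeGroup.toWord_one] at h
        exact List.cons_ne_nil _ _ h.symm
      · rw [h, List.tail_cons, FreeGroup.mk_toWord]
  len_mul_letter_le g p := by
    refine (FreeGroup.norm_mul_le _ _).trans (Nat.add_le_add_left ?_ _)
    exact FreeGroup.norm_mk_le
  exists_mul_letter g hg := by
    obtain h | ⟨L, p, h⟩ := g.toWord.eq_nil_or_concat'
    · exact absurd (FreeGroup.toWord_eq_nil_iff.1 h) hg
    · refine ⟨p, FreeGroup.mk L, ?_, ?_⟩
      · rw [FreeGroup.mul_mk, ← h, FreeGroup.mk_toWord]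
      · rw [FreeGroup.norm, toWord_mk_of_infix (g := g) (h ▸ (List.prefix_append L [p]).isInfix),
          FreeGroup.norm, h, List.length_append]
        rfl
  letter_unique a b x y h ha hb := by
    have h1 := toWord_mul_mk_of_norm_lt ha
    have h2 := toWord_mul_mk_of_norm_lt (g := b) (p := y) (h ▸ hb)
    rw [h, h2] at h1
    simpa using ((List.append_inj' h1 rfl).2).symm
  parent_mul_letter a x ha h := by
    rw [toWord_mul_mk_of_norm_lt h, List.tail_append_of_ne_nil, FreeGroup.mul_mk]
    exact fun h' => ha (FreeGroup.toWord_eq_nil_iff.1 h')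

end FreeGroup

/-! ### Monotonicity of `F` and the equality case for the free group. -/

section GroupChain

variable {r : ℕ}

theorem range_letter_freeGroup :
    Set.range (fun p : Fin r × Bool => FreeGroup.mk [p]) = groupLetters r := by
  ext g
  constructor
  · rintro ⟨⟨i, b⟩, rfl⟩
    cases b
    · exact Or.inr ⟨i, rfl⟩
    · exact Or.inl ⟨i, rfl⟩
  · rintro (⟨i, rfl⟩ | ⟨i, rfl⟩)
    · exact ⟨(i, true), rfl⟩
    · exact ⟨(i, false), rfl⟩

/-- Inversion preserves the norm and turns right multiplication into left multiplication, where the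
first letter is either added or cancelled. -/
theorem freeGroup_norm_mul_letter_ne (g : FreeGroup (Fin r)) (p : Fin r × Bool) :
    (g * FreeGroup.mk [p]).norm ≠ g.norm := by
  rw [← FreeGroup.norm_inv_eq (x := g), ← FreeGroup.norm_inv_eq, mul_inv_rev]
  have e : (FreeGroup.mk [p])⁻¹ = FreeGroup.mk [(p.1, !p.2)] := rfl
  rw [e]
  rcases toWord_mk_mul (p.1, !p.2) g⁻¹ with h | h
  all_goals
    have := congrArg List.length h
    rw [List.length_cons] at this
    simp only [FreeGroup.norm]
    omega

variable {B : ℕ → Finset (FreeGroup (Fin r))}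
  (hB : ∀ n g, g ∈ B n ↔ (freeGroupTree (Fin r)).len g ≤ n)

include hB

/-- Since a letter always changes the norm, `a` and `a * letter` cannot both have norm `n + 1`; one
of them lies in `B n`. -/
theorem freeGroup_ball_inter (n : ℕ) (p : Fin r × Bool) :
    B (n + 1) ∩ (B (n + 1)).image (· * FreeGroup.mk [p])
      = B n ∪ (B n).image (· * FreeGroup.mk [p]) := by
  have hmono : B n ⊆ B (n + 1) := fun c hc => by
    have := (hB n c).1 hc
    exact (hB _ c).2 (by omega)
  refine Finset.Subset.antisymm (fun g hg => ?_) (fun g hg => ?_)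
  · obtain ⟨h1, h2⟩ := Finset.mem_inter.1 hg
    obtain ⟨a, ha, rfl⟩ := Finset.mem_image.1 h2
    have hne : (freeGroupTree (Fin r)).len (a * FreeGroup.mk [p]) ≠ (freeGroupTree (Fin r)).len a :=
      freeGroup_norm_mul_letter_ne a p
    rw [hB] at h1 ha
    by_cases h : (freeGroupTree (Fin r)).len (a * FreeGroup.mk [p]) ≤ n
    · exact Finset.mem_union_left _ ((hB _ _).2 h)
    · exact Finset.mem_union_right _ (Finset.mem_image_of_mem _ ((hB _ _).2 (by omega)))
  · refine Finset.mem_inter.2 ⟨CayleyTree.union_image_subset hB n p hg, ?_⟩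
    rcases Finset.mem_union.1 hg with h | h
    · refine Finset.mem_image.2 ⟨g * FreeGroup.mk [(p.1, !p.2)], ?_, ?_⟩
      · have := (freeGroupTree (Fin r)).len_mul_letter_le g (p.1, !p.2)
        have := (hB _ _).1 h
        exact (hB _ _).2 (by omega)
      · have e : FreeGroup.mk [(p.1, !p.2)] = (FreeGroup.mk [p])⁻¹ := rfl
        rw [e, inv_mul_cancel_right]
    · exact Finset.image_subset_image hmono h

/-- With `E n = ∑ H (B n ∪ (B n)sᵢ)` over the `r` generators, the two bounds read `H (B (n+1)) ≤ (1
- 2r) H (B n) + 2 E n` and `E (n+1) + E n ≤ 2r H (B (n+1))`. Their sum is `F (n+1) ≤ F n`. -/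
theorem freeGroup_chain {H : Finset (FreeGroup (Fin r)) → ℝ}
    (hinv : ∀ Q g, H (Q.image (· * g)) = H Q)
    (hsub : ∀ P Q, H (P ∪ Q) + H (P ∩ Q) ≤ H P + H Q) {F : ℕ → ℝ}
    (hF : ∀ n, F n = (1 - 2 * (r : ℝ)) * H (B n)
      + ∑ i, H (B n ∪ (B n).image (· * FreeGroup.of i))) :
    Antitone F ∧ ((freeGroupTree (Fin r)).EntropyMarkov H ↔ ∀ n, F 0 ≤ F n) := by
  set e : Fin r × Bool → ℕ → ℝ := fun p n => H (B n ∪ (B n).image (· * FreeGroup.mk [p])) with he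
  have hF' : ∀ n, F n = (1 - 2 * (r : ℝ)) * H (B n) + ∑ i, e (i, true) n := hF
  -- Translation by `sᵢ` carries `B ∪ B sᵢ⁻¹` to `B sᵢ ∪ B`, so the `2r` letters contribute each
  -- generator twice.
  have hfalse : ∀ i n, e (i, false) n = e (i, true) n := by
    intro i n
    simp only [he]
    have hid : ((fun g => g * FreeGroup.mk [(i, true)]) ∘ fun g => g * FreeGroup.mk [(i, false)])
        = id := by
      funext g
      exact inv_mul_cancel_right g (FreeGroup.mk [(i, true)])
    rw [← hinv _ (FreeGroup.mk [(i, true)]), Finset.image_union, Finset.image_image, hid,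
      Finset.image_id, Finset.union_comm]
  have hsum : ∀ n, ∑ p, e p n = 2 * ∑ i, e (i, true) n := by
    intro n
    rw [Fintype.sum_prod_type, Finset.mul_sum]
    refine Finset.sum_congr rfl fun i _ => ?_
    rw [Fintype.sum_bool, hfalse]
    ring
  have hcard : (Fintype.card (Fin r × Bool) : ℝ) = 2 * r := by
    simp [mul_comm]
  have hinter : ∀ n p, H (B (n + 1) ∩ (B (n + 1)).image (· * FreeGroup.mk [p])) = e p n :=
    fun n p => by rw [freeGroup_ball_inter hB]
  have hatt : (freeGroupTree (Fin r)).AttSubmodular H := fun P Q _ => hsub P Q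
  have h1 : ∀ n, H (B (n + 1)) ≤ (1 - 2 * r) * H (B n) + 2 * ∑ i, e (i, true) n := by
    intro n
    have h := hatt.ball_succ_le hB n
    rw [hcard] at h
    have h' := hsum n
    simp only [he] at h' ⊢
    rw [h'] at h
    linarith
  have h2 : ∀ n p, e p (n + 1) + e p n ≤ 2 * H (B (n + 1)) := by
    intro n p
    have h := hatt.union_image_le hB hinv n p
    rwa [hinter] at h
  have h2' : ∀ n, ∑ i, e (i, true) (n + 1) + ∑ i, e (i, true) n ≤ 2 * r * H (B (n + 1)) := by
    intro n
    rw [← Finset.sum_add_distrib]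
    refine (Finset.sum_le_sum fun i _ => h2 n (i, true)).trans_eq ?_
    rw [Finset.sum_const, Finset.card_univ, Fintype.card_fin, nsmul_eq_mul]
    ring
  have hanti : Antitone F := by
    refine antitone_nat_of_succ_le fun n => ?_
    rw [hF', hF']
    linarith [h1 n, h2' n]
  refine ⟨hanti, fun hM n => ?_, fun hle => ?_⟩
  · obtain ⟨m1, m2⟩ := hM.eq hinv hB
    induction n with
    | zero => exact le_rfl
    | succ n ih =>
      refine ih.trans ?_
      have a1 := m1 n
      rw [hcard] at a1
      have a2 : 2 * r * H (B (n + 1)) ≤ ∑ i, e (i, true) (n + 1) + ∑ i, e (i, true) n := by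
        rw [← Finset.sum_add_distrib]
        refine le_trans (le_of_eq ?_) (Finset.sum_le_sum (f := fun _ => 2 * H (B (n + 1)))
          fun i _ => ?_)
        · rw [Finset.sum_const, Finset.card_univ, Fintype.card_fin, nsmul_eq_mul]
          ring
        · have := m2 n (i, true)
          rwa [hinter] at this
      have h' := hsum n
      simp only [he] at h'
      rw [h'] at a1
      rw [hF', hF']
      simp only [he] at a2 ⊢
      linarith
  · have hconst : ∀ n, F n = F 0 := fun n => le_antisymm (hanti (Nat.zero_le n)) (hle n)
    have hstep : ∀ n, F n ≤ F (n + 1) := fun n => by rw [hconst n, hconst (n + 1)]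
    have hun : ∀ n i, 2 * H (B (n + 1)) ≤ e (i, true) (n + 1) + e (i, true) n := by
      intro n
      have hs := hstep n
      rw [hF', hF'] at hs
      -- Constancy of `F` gives equality only for the sum over generators; as each term satisfies an
      -- inequality, equality holds for each generator.
      have heq : ∑ i, (e (i, true) (n + 1) + e (i, true) n) = ∑ _i : Fin r, 2 * H (B (n + 1)) := by
        rw [Finset.sum_const, Finset.card_univ, Fintype.card_fin, nsmul_eq_mul,
          Finset.sum_add_distrib]
        linarith [h1 n, h2' n]
      intro i
      exact ((Finset.sum_eq_sum_iff_of_le fun i _ => h2 n (i, true)).1 heq i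
        (Finset.mem_univ i)).ge
    refine CayleyTree.entropyMarkov_of_eq hinv hsub hB (fun n => ?_) (fun n p => ?_)
      fun n p _ => ?_
    · have hs := hstep n
      rw [hF', hF'] at hs
      rw [hcard]
      have h' := hsum n
      have h3 := h1 n
      have h4 := h2' n
      simp only [he] at h' hs h3 h4
      rw [h']
      linarith
    · rw [hinter]
      obtain ⟨i, b⟩ := p
      cases b
      · have := hun n i
        rwa [← hfalse, ← hfalse] at this
      · exact hun n i
    · rw [freeGroup_ball_inter hB]
      exact CayleyTree.sub_nonneg_of_closed hinv hsub (CayleyTree.closed_union_image hB n p)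
        (Finset.mem_union_left _ ((hB _ _).2 (by
          rw [(freeGroupTree (Fin r)).len_one]; exact Nat.zero_le n)))

end GroupChain

/-! ### Monotonicity of `F` and the equality case for the free semigroup. -/

section MonoidChain

variable {r : ℕ} {B : ℕ → Finset (FreeMonoid (Fin r))}
  (hB : ∀ n g, g ∈ B n ↔ (freeMonoidTree (Fin r)).len g ≤ n)

include hB

theorem freeMonoid_ball_inter [DecidableEq (FreeMonoid (Fin r))] (n : ℕ) (i : Fin r) :
    B (n + 1) ∩ (B (n + 1)).image (· * FreeMonoid.of i) = (B n).image (· * FreeMonoid.of i) := by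
  have hlen : ∀ a : FreeMonoid (Fin r), (freeMonoidTree (Fin r)).len (a * FreeMonoid.of i)
      = (freeMonoidTree (Fin r)).len a + 1 := fun a => by
    simp [freeMonoidTree, FreeMonoid.toList_mul]
  ext g
  simp only [Finset.mem_inter, Finset.mem_image]
  constructor
  · rintro ⟨h1, a, ha, rfl⟩
    rw [hB, hlen] at h1
    exact ⟨a, (hB _ _).2 (by omega), rfl⟩
  · rintro ⟨a, ha, rfl⟩
    rw [hB] at ha
    refine ⟨(hB _ _).2 ?_, a, (hB _ _).2 (by omega), rfl⟩
    rw [hlen]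
    omega

/-- Here there are `r` letters and the intersection is a translate of `B n`. With `E n = ∑ H (B n ∪
(B n)sᵢ)` the bounds are `H (B (n+1)) + r H (B n) ≤ H (B n) + E n` and `E (n+1) + r H (B n) ≤ 2r H
(B (n+1))`, which again sum to `F (n+1) ≤ F n`. -/
theorem freeMonoid_chain [DecidableEq (FreeMonoid (Fin r))] {H : Finset (FreeMonoid (Fin r)) → ℝ}
    (hinv : ∀ Q g, H (Q.image (· * g)) = H Q)
    (hsub : ∀ P Q, H (P ∪ Q) + H (P ∩ Q) ≤ H P + H Q) {F : ℕ → ℝ}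
    (hF : ∀ n, F n = (1 - 2 * (r : ℝ)) * H (B n)
      + ∑ i, H (B n ∪ (B n).image (· * FreeMonoid.of i))) :
    Antitone F ∧ ((freeMonoidTree (Fin r)).EntropyMarkov H ↔ ∀ n, F 0 ≤ F n) := by
  have hinter : ∀ n i, H (B (n + 1) ∩ (B (n + 1)).image (· * FreeMonoid.of i)) = H (B n) :=
    fun n p => by rw [freeMonoid_ball_inter hB, hinv]
  have hatt : (freeMonoidTree (Fin r)).AttSubmodular H := fun P Q _ => hsub P Q
  set e : Fin r → ℕ → ℝ := fun i n => H (B n ∪ (B n).image (· * FreeMonoid.of i)) with he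
  have h1 : ∀ n, H (B (n + 1)) + r * H (B n) ≤ H (B n) + ∑ i, e i n := by
    intro n
    have h := hatt.ball_succ_le hB n
    rwa [Fintype.card_fin] at h
  have h2 : ∀ n i, e i (n + 1) + H (B n) ≤ 2 * H (B (n + 1)) := by
    intro n i
    have h := hatt.union_image_le hB hinv n i
    rwa [hinter] at h
  have hconst : ∀ a : ℝ, ∑ _i : Fin r, a = r * a := fun a => by
    rw [Finset.sum_const, Finset.card_univ, Fintype.card_fin, nsmul_eq_mul]
  have h2' : ∀ n, ∑ i, e i (n + 1) + r * H (B n) ≤ r * (2 * H (B (n + 1))) := by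
    intro n
    rw [← hconst, ← hconst, ← Finset.sum_add_distrib]
    exact Finset.sum_le_sum fun i _ => h2 n i
  have hanti : Antitone F := by
    refine antitone_nat_of_succ_le fun n => ?_
    rw [hF, hF]
    have a1 := h1 n
    have a2 := h2' n
    simp only [he] at a1 a2
    linarith
  refine ⟨hanti, fun hM n => ?_, fun hle => ?_⟩
  · obtain ⟨m1, m2⟩ := hM.eq hinv hB
    induction n with
    | zero => exact le_rfl
    | succ n ih =>
      refine ih.trans ?_
      have a1 := m1 n
      rw [Fintype.card_fin] at a1
      have a2 : r * (2 * H (B (n + 1))) ≤ ∑ i, e i (n + 1) + r * H (B n) := by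
        rw [← hconst, ← hconst, ← Finset.sum_add_distrib]
        refine Finset.sum_le_sum fun i _ => ?_
        have := m2 n i
        rwa [hinter] at this
      rw [hF, hF]
      simp only [he] at a2
      linarith
  · have hstep : ∀ n, F n ≤ F (n + 1) := fun n => (hanti (Nat.zero_le n)).trans (hle (n + 1))
    refine CayleyTree.entropyMarkov_of_eq hinv hsub hB (fun n => ?_) (fun n i => ?_)
      fun n p h0 => ?_
    · have hs := hstep n
      rw [hF, hF] at hs
      rw [Fintype.card_fin]
      have h4 := h2' n
      simp only [he] at h4
      linarith
    · rw [hinter]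
      have hs := hstep n
      rw [hF, hF] at hs
      have heq : ∑ i, (e i (n + 1) + H (B n)) = ∑ _i : Fin r, 2 * H (B (n + 1)) := by
        rw [hconst, Finset.sum_add_distrib, hconst]
        have a1 := h1 n
        have a2 := h2' n
        simp only [he] at a1 a2 ⊢
        linarith
      exact ((Finset.sum_eq_sum_iff_of_le fun i _ => h2 n i).1 heq i (Finset.mem_univ i)).ge
    -- The intersection `(B n)sᵢ` misses the root, but by translation invariance its defect is that
    -- of `B n`, zero by induction.
    · rw [freeMonoid_ball_inter hB, CayleyTree.markovEntropy_image hinv, hinv]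
      exact (h0 n le_rfl).ge

end MonoidChain

/-! ### Conditional probabilities and mutual information. -/

namespace Partition

variable {X : Type*} [MeasurableSpace X] {μ : Measure X}

theorem sigma_eq_comap (β : Partition X) : β.sigma = MeasurableSpace.comap β.label ⊤ := by
  refine le_antisymm (MeasurableSpace.generateFrom_le fun A hA => ?_) ?_
  · exact ⟨{⟨A, hA⟩}, trivial, β.label_preimage_singleton ⟨A, hA⟩⟩
  · rintro _ ⟨U, -, rfl⟩
    have : Countable β.atoms := β.countable_atoms
    have e : β.label ⁻¹' U = ⋃ A ∈ U, (A : Set X) := by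
      ext x
      simp only [Set.mem_preimage, Set.mem_iUnion, exists_prop]
      exact ⟨fun h => ⟨_, h, β.mem_label x⟩, fun ⟨A, hA, hx⟩ => (β.label_eq_iff.2 hx).symm ▸ hA⟩
    rw [e]
    exact MeasurableSet.biUnion U.to_countable fun A _ =>
      MeasurableSpace.measurableSet_generateFrom A.2

theorem sigma_le (β : Partition X) : β.sigma ≤ ‹MeasurableSpace X› :=
  MeasurableSpace.generateFrom_le β.measurable

theorem sigma_le_sigma {β γ : Partition X}
    (h : ∀ x y, β.label x = β.label y → γ.label x = γ.label y) : γ.sigma ≤ β.sigma := by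
  rw [sigma_eq_comap, sigma_eq_comap]
  rintro _ ⟨U, -, rfl⟩
  refine ⟨β.label '' (γ.label ⁻¹' U), trivial, ?_⟩
  ext x
  constructor
  · rintro ⟨y, hy, hxy⟩
    change γ.label x ∈ U
    rw [← h y x hxy]
    exact hy
  · exact fun hx => ⟨x, hx, rfl⟩

theorem ae_label_ne_zero [IsFiniteMeasure μ] (β : Partition X) :
    ∀ᵐ x ∂μ, μ.real (β.label x : Set X) ≠ 0 := by
  have : Countable β.atoms := β.countable_atoms
  have h : ∀ᵐ x ∂μ, ∀ A : β.atoms, μ.real (A : Set X) = 0 → x ∉ (A : Set X) := by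
    refine ae_all_iff.2 fun A => ?_
    by_cases hA : μ.real (A : Set X) = 0
    · have h0 : μ (A : Set X) = 0 := (measureReal_eq_zero_iff).1 hA
      filter_upwards [measure_eq_zero_iff_ae_notMem.1 h0] with x hx _
      exact hx
    · exact Filter.Eventually.of_forall fun x h => absurd h hA
  filter_upwards [h] with x hx h0
  exact hx _ h0 (β.mem_label x)

/-- A function measurable for the σ-algebra of a countable partition is constant on atoms, so its
value on a non-null atom follows from one integral. This holds at every point of such an atom, not
just almost everywhere. -/
theorem condProb_sigma_apply [IsFiniteMeasure μ] (β : Partition X) {A : Set X}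
    (hA : MeasurableSet A) {x : X} (hx : μ.real (β.label x : Set X) ≠ 0) :
    condProb μ A β.sigma x = μ.real (A ∩ β.label x) / μ.real (β.label x : Set X) := by
  have hconst : ∀ y ∈ (β.label x : Set X), condProb μ A β.sigma y = condProb μ A β.sigma x := by
    have hm : Measurable[β.sigma] (condProb μ A β.sigma) := stronglyMeasurable_condExp.measurable
    intro y hy
    have hs : MeasurableSet[MeasurableSpace.comap β.label ⊤]
        (condProb μ A β.sigma ⁻¹' {condProb μ A β.sigma x}) := by
      rw [← sigma_eq_comap]
      exact hm (measurableSet_singleton _)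
    obtain ⟨U, -, hU⟩ := hs
    have hxU : x ∈ β.label ⁻¹' U := hU ▸ rfl
    have hyU : y ∈ β.label ⁻¹' U := by
      rw [Set.mem_preimage, β.label_eq_iff.2 hy]
      exact hxU
    rw [hU] at hyU
    exact hyU
  have hint : ∫ y in (β.label x : Set X), condProb μ A β.sigma y ∂μ
      = ∫ y in (β.label x : Set X), A.indicator (fun _ => (1 : ℝ)) y ∂μ :=
    setIntegral_condExp β.sigma_le ((integrable_const (1 : ℝ)).indicator hA)
      (MeasurableSpace.measurableSet_generateFrom (β.label x).2)
  have hBm : MeasurableSet (β.label x : Set X) := β.measurable _ (β.label x).2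
  rw [setIntegral_congr_fun hBm hconst, setIntegral_const, setIntegral_indicator hA,
    setIntegral_const, smul_eq_mul, smul_eq_mul, mul_one, Set.inter_comm] at hint
  rw [eq_div_iff hx, ← hint, mul_comm]

end Partition

namespace Action

variable {G : Type*} [Monoid G] {X : Type*} [MeasurableSpace X] {μ : Measure X}

theorem sigma_refine_eq (T : Action G μ) (α : Partition X) (Q : Set G) [Finite Q] :
    (T.refine α Q).sigma = ⨆ q ∈ Q, (T.pullback q α).sigma := by
  refine le_antisymm (MeasurableSpace.generateFrom_le ?_) (iSup₂_le fun q hq => ?_)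
  · rintro _ ⟨A, rfl⟩
    refine MeasurableSet.iInter fun q => ?_
    refine le_iSup₂_of_le (f := fun q _ => (T.pullback q α).sigma) (q : G) q.2 le_rfl _ ?_
    exact MeasurableSpace.measurableSet_generateFrom ⟨_, (A q).2, rfl⟩
  · refine Partition.sigma_le_sigma fun x y h => ?_
    rw [refine_label_eq_iff] at h
    rw [pullback_label_eq_iff]
    exact h q hq

theorem sigma_refine_mono (T : Action G μ) (α : Partition X) {P Q : Set G} [Finite P] [Finite Q]
    (h : P ⊆ Q) : (T.refine α P).sigma ≤ (T.refine α Q).sigma := by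
  rw [sigma_refine_eq, sigma_refine_eq]
  exact biSup_mono h

theorem refine_label_subset (T : Action G μ) (α : Partition X) {P : Set G} [Finite P] {g : G}
    (hg : g ∈ P) (x : X) :
    ((T.refine α P).label x : Set X) ⊆ ((T.pullback g α).label x : Set X) := by
  intro y hy
  rw [← Partition.label_eq_iff] at hy ⊢
  rw [refine_label_eq_iff] at hy
  rw [pullback_label_eq_iff]
  exact hy g hg

/-- On an atom of `α^P` both sides are ratios of measures, and since `g ∈ P` it lies inside a single
atom of `T_g⁻¹ α`. Almost every point lies in non-null atoms, and an almost everywhere identity can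
be evaluated in any non-null atom. -/
theorem forall_condProb_eq_iff_condInfo [IsProbabilityMeasure μ] (T : Action G μ) (α : Partition X)
    {P : Set G} [Finite P] {g : G} (hg : g ∈ P) (c : G) :
    (∀ A ∈ α.atoms, condProb μ (T.map c ⁻¹' A) (T.refine α P).sigma
      =ᵐ[μ] condProb μ (T.map c ⁻¹' A) (T.pullback g α).sigma) ↔
    condInfo μ (T.pullback c α).label (T.refine α P).label (T.pullback g α).label = 0 := by
  have hmeas : ∀ A ∈ α.atoms, MeasurableSet (T.map c ⁻¹' A) := fun A hA =>
    (T.measurePreserving c).measurable (α.measurable A hA)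
  rw [condInfo_eq_zero_iff]
  simp only [Partition.label_preimage_singleton]
  constructor
  · rintro h ⟨_, A, hA, rfl⟩ j k hjk
    have hpos : 0 < μ ((j : Set X) ∩ k) := by
      rw [pos_iff_ne_zero]
      exact fun h0 => hjk (by simp [Measure.real, h0])
    obtain ⟨x, ⟨hxj, hxk⟩, hx⟩ :=
      ((frequently_ae_mem_iff.2 hpos.ne').and_eventually (h A hA)).exists
    rw [← Partition.label_eq_iff] at hxj hxk
    subst hxj hxk
    have hsub := T.refine_label_subset α hg x
    rw [Set.inter_eq_left.2 hsub] at hjk ⊢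
    have hk : μ.real ((T.pullback g α).label x : Set X) ≠ 0 := fun h0 =>
      hjk (measureReal_mono_null hsub h0)
    rwa [Partition.condProb_sigma_apply _ (hmeas A hA) hjk,
      Partition.condProb_sigma_apply _ (hmeas A hA) hk] at hx
  · intro h A hA
    filter_upwards [(T.refine α P).ae_label_ne_zero, (T.pullback g α).ae_label_ne_zero]
      with x hj hk
    have hsub := T.refine_label_subset α hg x
    rw [Partition.condProb_sigma_apply _ (hmeas A hA) hj,
      Partition.condProb_sigma_apply _ (hmeas A hA) hk]
    have := h ⟨_, A, hA, rfl⟩ ((T.refine α P).label x) ((T.pullback g α).label x)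
    rw [Set.inter_eq_left.2 hsub] at this
    exact this hj

/-- This reduces an infinite past to finite subsets. One direction is the tower property; for the
other, the σ-algebras of the `α^P` form a π-system generating the full join, on which the defining
integrals of the conditional expectation are checked. -/
theorem condProb_iSup_eq_iff [IsProbabilityMeasure μ] (T : Action G μ) (α : Partition X)
    {W : Set G} {g : G} (hg : g ∈ W) {A : Set X} (hA : MeasurableSet A) :
    condProb μ A (⨆ f ∈ W, (T.pullback f α).sigma) =ᵐ[μ] condProb μ A (T.pullback g α).sigma ↔
    ∀ P : Finset G, (P : Set G) ⊆ W → g ∈ P →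
      condProb μ A (T.refine α (P : Set G)).sigma =ᵐ[μ] condProb μ A (T.pullback g α).sigma := by
  classical
  have hWle : (⨆ f ∈ W, (T.pullback f α).sigma) ≤ ‹MeasurableSpace X› :=
    iSup₂_le fun f _ => (T.pullback f α).sigma_le
  have hPle : ∀ P : Finset G, (P : Set G) ⊆ W →
      (T.refine α (P : Set G)).sigma ≤ ⨆ f ∈ W, (T.pullback f α).sigma := fun P hP => by
    rw [sigma_refine_eq]
    exact biSup_mono hP
  have hgP : ∀ P : Finset G, g ∈ P → (T.pullback g α).sigma ≤ (T.refine α (P : Set G)).sigma :=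
    fun P hgP => by
      rw [sigma_refine_eq]
      exact le_iSup₂_of_le (f := fun q _ => (T.pullback q α).sigma) g hgP le_rfl
  have hint : Integrable (A.indicator fun _ => (1 : ℝ)) μ := (integrable_const 1).indicator hA
  constructor
  · intro h P hP hgP'
    have h1 := condExp_condExp_of_le (μ := μ) (f := A.indicator fun _ => (1 : ℝ)) (hPle P hP) hWle
    have h2 := condExp_congr_ae (m := (T.refine α (P : Set G)).sigma) h
    have h3 : μ[condProb μ A (T.pullback g α).sigma|(T.refine α (P : Set G)).sigma]
        = condProb μ A (T.pullback g α).sigma :=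
      condExp_of_stronglyMeasurable (Partition.sigma_le _)
        (stronglyMeasurable_condExp.mono (hgP P hgP')) integrable_condExp
    exact h1.symm.trans (h2.trans (Filter.EventuallyEq.of_eq h3))
  · intro h
    refine (ae_eq_condExp_of_forall_setIntegral_eq hWle hint
      (fun s _ _ => integrable_condExp.integrableOn) ?_
      (stronglyMeasurable_condExp.mono (le_iSup₂_of_le
        (f := fun q _ => (T.pullback q α).sigma) g hg le_rfl)).aestronglyMeasurable).symm
    set C : Set (Set X) := {s | ∃ P : Finset G, (P : Set G) ⊆ W ∧ g ∈ P ∧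
      MeasurableSet[(T.refine α (P : Set G)).sigma] s} with hC
    have hgen : (⨆ f ∈ W, (T.pullback f α).sigma) = MeasurableSpace.generateFrom C := by
      refine le_antisymm (iSup₂_le fun f hf s hs => ?_) (MeasurableSpace.generateFrom_le ?_)
      · refine MeasurableSpace.measurableSet_generateFrom ⟨{f, g}, ?_, by simp, ?_⟩
        · intro q hq
          rw [Finset.coe_insert, Finset.coe_singleton] at hq
          rcases hq with rfl | rfl
          exacts [hf, hg]
        · rw [sigma_refine_eq]
          exact le_iSup₂_of_le (f := fun q _ => (T.pullback q α).sigma) f (by simp) le_rfl s hs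
      · rintro s ⟨P, hP, -, hs⟩
        exact hPle P hP s hs
    have hpi : IsPiSystem C := by
      rintro s ⟨P, hP, hgP, hs⟩ t ⟨Q, hQ, -, ht⟩ -
      refine ⟨P ∪ Q, ?_, Finset.mem_union_left _ hgP, ?_⟩
      · rw [Finset.coe_union]
        exact Set.union_subset hP hQ
      · refine MeasurableSet.inter ?_ ?_
        · exact T.sigma_refine_mono α (by simp) s hs
        · exact T.sigma_refine_mono α (by simp) t ht
    rintro s hs -
    have hint' : Integrable (condProb μ A (T.pullback g α).sigma) μ := integrable_condExp
    have hbasic : ∀ s ∈ C, ∫ x in s, condProb μ A (T.pullback g α).sigma x ∂μ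
        = ∫ x in s, A.indicator (fun _ => (1 : ℝ)) x ∂μ := by
      rintro s ⟨P, hP, hgP, hs⟩
      rw [← setIntegral_condExp (Partition.sigma_le _) hint hs]
      exact integral_congr_ae (ae_restrict_of_ae (h P hP hgP).symm)
    have huniv : ∫ x, condProb μ A (T.pullback g α).sigma x ∂μ
        = ∫ x, A.indicator (fun _ => (1 : ℝ)) x ∂μ := integral_condExp (Partition.sigma_le _)
    change ∫ x in s, condProb μ A (T.pullback g α).sigma x ∂μ = _
    induction s, hs using MeasurableSpace.induction_on_inter hgen hpi with
    | empty => simp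
    | basic s hs => exact hbasic s hs
    | compl s hs ih =>
      have hs' := hWle s hs
      rw [setIntegral_compl hs' hint', setIntegral_compl hs' hint, ih, huniv]
    | iUnion f hd hf ih =>
      rw [integral_iUnion (fun i => hWle _ (hf i)) hd hint'.integrableOn,
        integral_iUnion (fun i => hWle _ (hf i)) hd hint.integrableOn]
      exact tsum_congr ih

variable [DecidableEq G]

/-- The information is the defect in submodularity; finite entropy is what allows it to be
cancelled. -/
theorem condInfo_eq_zero_iff_finsetEntropy [IsProbabilityMeasure μ] (T : Action G μ)
    {α : Partition X} (hα : α.entropy μ < ∞) {P : Finset G} {g : G} (hg : g ∈ P) (c : G) :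
    condInfo μ (T.pullback c α).label (T.refine α (P : Set G)).label (T.pullback g α).label = 0 ↔
      T.finsetEntropy α (insert c P) + T.finsetEntropy α {g}
        = T.finsetEntropy α P + T.finsetEntropy α {g, c} := by
  have : Countable (T.refine α (P : Set G)).atoms := Partition.countable_atoms _
  have : Countable (T.pullback c α).atoms := Partition.countable_atoms _
  have h := ent_submodular (μ := μ) (T.pullback c α).measurableSet_label_fiber
    (T.refine α (P : Set G)).measurableSet_label_fiber (T.pullback g α).measurableSet_label_fiber
  rw [ent_congr (φ := fun x => ((T.pullback c α).label x, (T.refine α (P : Set G)).label x,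
      (T.pullback g α).label x)) (ψ := (T.refine α ((insert c P : Finset G) : Set G)).label),
    ent_congr (φ := (T.pullback g α).label)
      (ψ := (T.refine α (({g} : Finset G) : Set G)).label),
    ent_congr (φ := fun x => ((T.pullback c α).label x, (T.pullback g α).label x))
      (ψ := (T.refine α (({g, c} : Finset G) : Set G)).label),
    ent_congr (φ := fun x => ((T.refine α (P : Set G)).label x, (T.pullback g α).label x))
      (ψ := (T.refine α (P : Set G)).label)] at h
  · simp only [← Partition.entropy_eq_ent] at h
    have hfin : ∀ Q : Finset G, (T.refine α (Q : Set G)).entropy μ ≠ ∞ := fun Q =>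
      (T.entropy_refine_lt_top hα).ne
    simp only [finsetEntropy]
    rw [← ENNReal.toReal_add (hfin _) (hfin _), ← ENNReal.toReal_add (hfin _) (hfin _),
      ENNReal.toReal_eq_toReal_iff' (ENNReal.add_ne_top.2 ⟨hfin _, hfin _⟩)
        (ENNReal.add_ne_top.2 ⟨hfin _, hfin _⟩), add_comm ((T.refine α (P : Set G)).entropy μ), ← h]
    constructor
    · intro h0
      rw [h0, add_zero]
    · intro h0
      exact (ENNReal.add_right_inj (ENNReal.add_ne_top.2 ⟨hfin _, hfin _⟩)).1
        ((add_zero _).trans h0).symm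
  all_goals
    intro x y
    simp only [Prod.mk.injEq, refine_label_eq_iff, pullback_label_eq_iff, Finset.mem_coe,
      Finset.mem_insert, Finset.mem_singleton]
    grind

/-- The Markov property at one edge, expressed by joint entropies. -/
theorem condProb_iSup_eq_iff_finsetEntropy [IsProbabilityMeasure μ] (T : Action G μ)
    {α : Partition X} (hα : α.entropy μ < ∞) {W : Set G} {g : G} (hg : g ∈ W) (c : G) :
    (∀ A ∈ α.atoms, condProb μ (T.map c ⁻¹' A) (⨆ f ∈ W, (T.pullback f α).sigma)
      =ᵐ[μ] condProb μ (T.map c ⁻¹' A) (T.pullback g α).sigma) ↔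
    ∀ P : Finset G, (P : Set G) ⊆ W → g ∈ P →
      T.finsetEntropy α (insert c P) + T.finsetEntropy α {g}
        = T.finsetEntropy α P + T.finsetEntropy α {g, c} := by
  have hmeas : ∀ A ∈ α.atoms, MeasurableSet (T.map c ⁻¹' A) := fun A hA =>
    (T.measurePreserving c).measurable (α.measurable A hA)
  constructor
  · intro h P hP hgP
    rw [← T.condInfo_eq_zero_iff_finsetEntropy hα hgP,
      ← T.forall_condProb_eq_iff_condInfo α (P := (P : Set G)) hgP]
    exact fun A hA => (T.condProb_iSup_eq_iff α hg (hmeas A hA)).1 (h A hA) P hP hgP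
  · intro h A hA
    refine (T.condProb_iSup_eq_iff α hg (hmeas A hA)).2 fun P hP hgP => ?_
    have h1 := h P hP hgP
    rw [← T.condInfo_eq_zero_iff_finsetEntropy hα hgP,
      ← T.forall_condProb_eq_iff_condInfo α (P := (P : Set G)) hgP] at h1
    exact h1 A hA

end Action

/-! ### Pasts in the Cayley graph as complements of branches. -/

namespace CayleyTree

variable {G Λ : Type*} [Monoid G] {letter : Λ → G} (t : CayleyTree letter)

theorem leftCayley_adj_iff {u v : G} : (leftCayley (Set.range letter)).Adj u v ↔ t.Adj u v := by
  rw [leftCayley, SimpleGraph.fromRel_adj, adj_iff]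
  constructor
  · rintro ⟨-, ⟨_, ⟨x, rfl⟩, h⟩ | ⟨_, ⟨x, rfl⟩, h⟩⟩
    exacts [⟨x, Or.inr h⟩, ⟨x, Or.inl h⟩]
  · intro h
    refine ⟨fun huv => t.not_adj_self u ?_, ?_⟩
    · rw [adj_iff]
      rwa [← huv] at h
    · obtain ⟨x, h | h⟩ := h
      exacts [Or.inr ⟨_, ⟨x, rfl⟩, h⟩, Or.inl ⟨_, ⟨x, rfl⟩, h⟩]

variable {t}

/-- The only edge joining the branch of descendants of `c` to its complement runs from `c` to its
parent, so a path entering the branch visits the parent. -/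
theorem parent_mem_support {d c : G} (p : (leftCayley (Set.range letter)).Walk d c)
    (hd : ¬ t.IsDesc c d) : t.parent c ∈ p.support := by
  induction p with
  | nil => exact absurd (IsDesc.refl t _) hd
  | @cons d v c h p ih =>
    rw [SimpleGraph.Walk.support_cons]
    by_cases hv : t.IsDesc c v
    · rcases t.leftCayley_adj_iff.1 h with ⟨-, h'⟩ | ⟨-, h'⟩
      · rw [← h'] at hv
        exact absurd hv.of_parent hd
      · by_cases hvc : v = c
        · have hd' : t.parent c = d := by rw [← hvc, h']
          exact hd' ▸ List.mem_cons_self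
        · have := hv.parent_of_ne hvc
          rw [h'] at this
          exact absurd this hd
    · exact List.mem_cons_of_mem _ (ih hv)

theorem exists_walk_of_isDesc {d c : G} (hc : c ≠ 1) (hd : t.IsDesc c d) :
    ∃ p : (leftCayley (Set.range letter)).Walk d c, ∀ v ∈ p.support, t.IsDesc c v := by
  obtain ⟨k, hk⟩ := hd
  induction k generalizing d with
  | zero =>
    obtain rfl : d = c := hk
    refine ⟨SimpleGraph.Walk.nil, fun v hv => ?_⟩
    rw [SimpleGraph.Walk.support_nil, List.mem_singleton] at hv
    rw [hv]
    exact IsDesc.refl t d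
  | succ k ih =>
    obtain ⟨p, hp⟩ := ih (d := t.parent d) hk
    have hd : t.IsDesc c d := ⟨k + 1, hk⟩
    have hd1 : d ≠ 1 := fun h => not_isDesc_one hc (h ▸ hd)
    refine ⟨SimpleGraph.Walk.cons (t.leftCayley_adj_iff.2 (Or.inl ⟨hd1, rfl⟩)) p, fun v hv => ?_⟩
    rw [SimpleGraph.Walk.support_cons] at hv
    rcases List.mem_cons.1 hv with rfl | hv
    exacts [hd, hp v hv]

theorem mem_past_parent_iff {c d : G} (hc : c ≠ 1) :
    d ∈ past (Set.range letter) c (t.parent c) ↔ ¬ t.IsDesc c d := by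
  constructor
  · intro h hd
    obtain ⟨p, hp⟩ := exists_walk_of_isDesc hc hd
    exact not_isDesc_parent hc (hp _ (h p))
  · exact fun h p => parent_mem_support p h

end CayleyTree

section Translation

variable {G : Type*} [Monoid G]

theorem mem_past_self (S : Set G) (c g : G) : g ∈ past S c g := fun p => p.start_mem_support

/-- Right multiplication is an injective endomorphism of the left-Cayley graph: a path from `d` to
`c` is carried to one from `d * g` to `c * g`, and injectivity brings the visited vertex back. -/
theorem mem_past_of_mul_right_mem [IsRightCancelMul G] {S : Set G} {c d k g : G}
    (h : d * g ∈ past S (c * g) (k * g)) : d ∈ past S c k := by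
  intro p
  let φ : leftCayley S →g leftCayley S :=
    { toFun := (· * g)
      map_rel' := by
        intro u v huv
        rw [leftCayley, SimpleGraph.fromRel_adj] at huv ⊢
        obtain ⟨hne, hs⟩ := huv
        refine ⟨fun h => hne (mul_right_cancel h), ?_⟩
        rcases hs with ⟨s, hs, rfl⟩ | ⟨s, hs, rfl⟩
        · exact Or.inl ⟨s, hs, mul_assoc s u g⟩
        · exact Or.inr ⟨s, hs, mul_assoc s v g⟩ }
  have hm := h (p.map φ)
  rw [SimpleGraph.Walk.support_map, List.mem_map] at hm
  obtain ⟨v, hv, hvk⟩ := hm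
  have : v = k := mul_right_cancel hvk
  exact this ▸ hv

end Translation

/-! ### The Markov property as a property of the joint entropy. -/

namespace CayleyTree

variable {X : Type*} [MeasurableSpace X] {μ : Measure X} [IsProbabilityMeasure μ]

theorem entropyMarkov_of_isMarkov {G Λ : Type*} [Monoid G] [DecidableEq G] {letter : Λ → G}
    (t : CayleyTree letter) (T : Action G μ) {α : Partition X} (hα : α.entropy μ < ∞)
    (h : T.IsMarkov (Set.range letter) α) : t.EntropyMarkov (T.finsetEntropy α) := by
  intro c P hc hp hd
  obtain ⟨x, hx⟩ := t.exists_letter_mul_parent c hc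
  have h1 := h (letter x) ⟨x, rfl⟩ (t.parent c)
  rw [← hx, T.condProb_iSup_eq_iff_finsetEntropy hα (mem_past_self _ _ _)] at h1
  exact h1 P (fun d hdP => (mem_past_parent_iff hc).2 (hd d hdP)) hp

theorem condProb_eq_of_entropyMarkov {G Λ : Type*} [Monoid G] [DecidableEq G] {letter : Λ → G}
    (t : CayleyTree letter) (T : Action G μ) {α : Partition X} (hα : α.entropy μ < ∞)
    (h : t.EntropyMarkov (T.finsetEntropy α)) {x : Λ} {g : G} (hne : letter x * g ≠ 1)
    (hg : t.parent (letter x * g) = g) : ∀ A ∈ α.atoms,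
    condProb μ (T.map (letter x * g) ⁻¹' A)
        (⨆ f ∈ past (Set.range letter) (letter x * g) g, (T.pullback f α).sigma)
      =ᵐ[μ] condProb μ (T.map (letter x * g) ⁻¹' A) (T.pullback g α).sigma := by
  rw [T.condProb_iSup_eq_iff_finsetEntropy hα (mem_past_self _ _ _)]
  intro P hP hgP
  have h1 := h (letter x * g) P hne (by rwa [hg]) fun d hd => by
    rw [← mem_past_parent_iff hne, hg]
    exact hP hd
  rwa [hg] at h1

/-- `EntropyMarkov` concerns only edges directed away from the root, whereas `IsMarkov` also asks
for those directed towards it. Translation by `g⁻¹` moves the edge from `g` to `letter x * g` onto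
the one from `1` to `letter x`, which leaves the root. -/
theorem isMarkov_iff_of_group {G Λ : Type*} [Group G] [DecidableEq G] {letter : Λ → G}
    (t : CayleyTree letter) (T : Action G μ) {α : Partition X} (hα : α.entropy μ < ∞) :
    T.IsMarkov (Set.range letter) α ↔ t.EntropyMarkov (T.finsetEntropy α) := by
  refine ⟨t.entropyMarkov_of_isMarkov T hα, ?_⟩
  rintro h _ ⟨x, rfl⟩ g
  rw [T.condProb_iSup_eq_iff_finsetEntropy hα (mem_past_self _ _ _)]
  intro P hP hgP
  obtain ⟨hx1, hx2⟩ : letter x ≠ 1 ∧ t.parent (letter x) = 1 := by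
    have hx := t.letter_mul x 1
    rw [mul_one] at hx
    exact hx.resolve_right fun h => h.1 rfl
  have h1 := h (letter x) (P.image (· * g⁻¹)) hx1
    (by rw [hx2]; exact Finset.mem_image.2 ⟨g, hgP, mul_inv_cancel g⟩) (by
      intro d hd
      obtain ⟨f, hf, rfl⟩ := Finset.mem_image.1 hd
      rw [← mem_past_parent_iff hx1, hx2]
      apply mem_past_of_mul_right_mem (g := g)
      rw [inv_mul_cancel_right, one_mul]
      exact hP hf)
  have e1 : insert (letter x) (P.image (· * g⁻¹))
      = (insert (letter x * g) P).image (· * g⁻¹) := by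
    rw [Finset.image_insert, mul_inv_cancel_right]
  have e2 : ({1} : Finset G) = ({g} : Finset G).image (· * g⁻¹) := by
    rw [Finset.image_singleton, mul_inv_cancel]
  have e3 : ({1, letter x} : Finset G) = ({g, letter x * g} : Finset G).image (· * g⁻¹) := by
    rw [Finset.image_insert, Finset.image_singleton, mul_inv_cancel, mul_inv_cancel_right]
  rwa [hx2, e1, e3, e2, T.finsetEntropy_image_mul_right, T.finsetEntropy_image_mul_right,
    T.finsetEntropy_image_mul_right, T.finsetEntropy_image_mul_right] at h1

end CayleyTree

/-! ### From the chain of values of `F` to the infimum `f`. -/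

section Main

-- Since `B 0 = {1}`, `F(α)` is the term `n = 0` of an antitone sequence, although the infimum
-- starts at `n = 1`. It equals the infimum exactly when no later term falls below it.
open Classical in
theorem isMarkov_iff_of_antitone {G Λ : Type*} [Monoid G] {letter : Λ → G} (t : CayleyTree letter)
    {X : Type*} [MeasurableSpace X] {μ : Measure X} {r : ℕ} (s : Fin r → G) {S : Set G} [Finite S]
    (hS : Set.range letter = S) (T : Action G μ) (α : Partition X)
    (h : ∀ (B : ℕ → Finset G) (F : ℕ → ℝ), (∀ n g, g ∈ B n ↔ t.len g ≤ n) →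
      (∀ n, F n = (1 - 2 * (r : ℝ)) * T.finsetEntropy α (B n)
        + ∑ i, T.finsetEntropy α (B n ∪ (B n).image (· * s i))) →
      Antitone F ∧ (T.IsMarkov S α ↔ ∀ n, F 0 ≤ F n)) :
    T.littleF s S α ≤ ((T.bigF s α : ℝ) : EReal) ∧
      (T.IsMarkov S α ↔ ((T.bigF s α : ℝ) : EReal) = T.littleF s S α) := by
  set B : ℕ → Finset G := fun n => (Set.toFinite (ball S n)).toFinset with hBdef
  have hB : ∀ n g, g ∈ B n ↔ t.len g ≤ n := by
    intro n g
    rw [hBdef, Set.Finite.mem_toFinset, ← hS, t.mem_ball_iff]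
  have hBcoe : ∀ n, ball S n = (B n : Set G) := fun n =>
    ((Set.toFinite (ball S n)).coe_toFinset).symm
  set F : ℕ → ℝ := fun n => T.bigF s (T.refine α (ball S n)) with hFdef
  obtain ⟨hanti, hiff⟩ := h B F hB fun n => T.bigF_refine_eq s α (B n) (hBcoe n)
  have hF0 : T.bigF s α = F 0 := by
    have hB0 : B 0 = {1} := by
      ext g
      rw [hB, Finset.mem_singleton]
      exact ⟨fun h => t.eq_one_of_len_eq_zero (Nat.le_zero.1 h), fun h => by rw [h, t.len_one]⟩
    change T.bigF s α = T.bigF s (T.refine α (ball S 0))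
    rw [T.bigF_eq, T.bigF_refine_eq s α (B 0) (hBcoe 0), hB0]
  have hlittle : T.littleF s S α = ⨅ (n : ℕ) (_ : 0 < n), ((F n : ℝ) : EReal) := rfl
  have hle : T.littleF s S α ≤ ((F 0 : ℝ) : EReal) := by
    rw [hlittle]
    exact (iInf₂_le 1 one_pos).trans (EReal.coe_le_coe_iff.2 (hanti zero_le_one))
  rw [hF0]
  refine ⟨hle, hiff.trans ⟨fun hall => ?_, fun heq n => ?_⟩⟩
  · refine le_antisymm ?_ hle
    rw [hlittle]
    exact le_iInf₂ fun n _ => EReal.coe_le_coe_iff.2 (hall n)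
  · rcases Nat.eq_zero_or_pos n with rfl | hn
    · exact le_rfl
    · rw [← EReal.coe_le_coe_iff, heq, hlittle]
      exact iInf₂_le n hn

theorem freeGroup_isMarkov_iff {r : ℕ} {X : Type*} [MeasurableSpace X] (μ : Measure X)
    [IsProbabilityMeasure μ] (T : Action (FreeGroup (Fin r)) μ) (α : Partition X)
    (hα : α.entropy μ < ∞) :
    T.littleF FreeGroup.of (groupLetters r) α ≤ ((T.bigF FreeGroup.of α : ℝ) : EReal) ∧
      (T.IsMarkov (groupLetters r) α ↔
        ((T.bigF FreeGroup.of α : ℝ) : EReal) = T.littleF FreeGroup.of (groupLetters r) α) := by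
  refine isMarkov_iff_of_antitone (freeGroupTree (Fin r)) FreeGroup.of range_letter_freeGroup T α
    fun B F hB hF => ?_
  rw [← range_letter_freeGroup, (freeGroupTree (Fin r)).isMarkov_iff_of_group T hα]
  refine freeGroup_chain hB (T.finsetEntropy_image_mul_right α) (T.finsetEntropy_submodular hα) ?_
  convert hF

open Classical in
theorem freeMonoid_isMarkov_iff {r : ℕ} {X : Type*} [MeasurableSpace X] (μ : Measure X)
    [IsProbabilityMeasure μ] (T : Action (FreeMonoid (Fin r)) μ) (α : Partition X)
    (hα : α.entropy μ < ∞) :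
    T.littleF FreeMonoid.of (monoidLetters r) α ≤ ((T.bigF FreeMonoid.of α : ℝ) : EReal) ∧
      (T.IsMarkov (monoidLetters r) α ↔
        ((T.bigF FreeMonoid.of α : ℝ) : EReal) = T.littleF FreeMonoid.of (monoidLetters r) α) := by
  refine isMarkov_iff_of_antitone (freeMonoidTree (Fin r)) FreeMonoid.of
    (S := monoidLetters r) rfl T α
    fun B F hB hF => ?_
  have hM : T.IsMarkov (monoidLetters r) α ↔
      (freeMonoidTree (Fin r)).EntropyMarkov (T.finsetEntropy α) := by
    refine ⟨(freeMonoidTree (Fin r)).entropyMarkov_of_isMarkov T hα, ?_⟩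
    rintro h _ ⟨i, rfl⟩ g
    exact (freeMonoidTree (Fin r)).condProb_eq_of_entropyMarkov T hα h
      (fun h => List.cons_ne_nil i g.toList h) rfl
  rw [hM]
  exact freeMonoid_chain hB (T.finsetEntropy_image_mul_right α) (T.finsetEntropy_submodular hα) hF

end Main

end FreeMarkov

theorem theorem10p1 (r : ℕ) :
    -- the characterization, for actions of the free group of rank `r`
    (∀ {X : Type*} [MeasurableSpace X] (μ : Measure X) [IsProbabilityMeasure μ]
        (T : FreeMarkov.Action (FreeGroup (Fin r)) μ) (α : FreeMarkov.Partition X),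
        α.entropy μ < ∞ →
        (T.IsMarkov (FreeMarkov.groupLetters r) α ↔
          ((T.bigF FreeGroup.of α : ℝ) : EReal)
            = T.littleF FreeGroup.of (FreeMarkov.groupLetters r) α)) ∧
    -- the characterization, for actions of the free semigroup with identity of rank `r`
    (∀ {X : Type*} [MeasurableSpace X] (μ : Measure X) [IsProbabilityMeasure μ]
        (T : FreeMarkov.Action (FreeMonoid (Fin r)) μ) (α : FreeMarkov.Partition X),
        α.entropy μ < ∞ →
        (T.IsMarkov (FreeMarkov.monoidLetters r) α ↔
          ((T.bigF FreeMonoid.of α : ℝ) : EReal)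
            = T.littleF FreeMonoid.of (FreeMarkov.monoidLetters r) α)) ∧
    -- invariant measures on `K^G`, for the free group
    (∀ {K : Type*} [Countable K] [MeasurableSpace K] [DiscreteMeasurableSpace K]
        (μ : Measure (FreeGroup (Fin r) → K)) [IsProbabilityMeasure μ]
        (hμ : ∀ g, MeasurePreserving (FreeMarkov.shift (FreeGroup (Fin r)) K g) μ μ),
        (FreeMarkov.canonicalPartition (FreeGroup (Fin r)) K).entropy μ < ∞ →
        (FreeMarkov.shiftAction μ hμ).littleF FreeGroup.of (FreeMarkov.groupLetters r)
            (FreeMarkov.canonicalPartition (FreeGroup (Fin r)) K)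
          ≤ (((FreeMarkov.shiftAction μ hμ).bigF FreeGroup.of
            (FreeMarkov.canonicalPartition (FreeGroup (Fin r)) K) : ℝ) : EReal) ∧
        ((FreeMarkov.shiftAction μ hμ).littleF FreeGroup.of (FreeMarkov.groupLetters r)
            (FreeMarkov.canonicalPartition (FreeGroup (Fin r)) K)
          = (((FreeMarkov.shiftAction μ hμ).bigF FreeGroup.of
            (FreeMarkov.canonicalPartition (FreeGroup (Fin r)) K) : ℝ) : EReal) ↔
          (FreeMarkov.shiftAction μ hμ).IsMarkov (FreeMarkov.groupLetters r)
            (FreeMarkov.canonicalPartition (FreeGroup (Fin r)) K))) ∧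
    -- invariant measures on `K^G`, for the free semigroup with identity
    (∀ {K : Type*} [Countable K] [MeasurableSpace K] [DiscreteMeasurableSpace K]
        (μ : Measure (FreeMonoid (Fin r) → K)) [IsProbabilityMeasure μ]
        (hμ : ∀ g, MeasurePreserving (FreeMarkov.shift (FreeMonoid (Fin r)) K g) μ μ),
        (FreeMarkov.canonicalPartition (FreeMonoid (Fin r)) K).entropy μ < ∞ →
        (FreeMarkov.shiftAction μ hμ).littleF FreeMonoid.of (FreeMarkov.monoidLetters r)
            (FreeMarkov.canonicalPartition (FreeMonoid (Fin r)) K)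
          ≤ (((FreeMarkov.shiftAction μ hμ).bigF FreeMonoid.of
            (FreeMarkov.canonicalPartition (FreeMonoid (Fin r)) K) : ℝ) : EReal) ∧
        ((FreeMarkov.shiftAction μ hμ).littleF FreeMonoid.of (FreeMarkov.monoidLetters r)
            (FreeMarkov.canonicalPartition (FreeMonoid (Fin r)) K)
          = (((FreeMarkov.shiftAction μ hμ).bigF FreeMonoid.of
            (FreeMarkov.canonicalPartition (FreeMonoid (Fin r)) K) : ℝ) : EReal) ↔
          (FreeMarkov.shiftAction μ hμ).IsMarkov (FreeMarkov.monoidLetters r)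
            (FreeMarkov.canonicalPartition (FreeMonoid (Fin r)) K))) := by
  refine ⟨fun μ _ T α hα => (FreeMarkov.freeGroup_isMarkov_iff μ T α hα).2,
    fun μ _ T α hα => (FreeMarkov.freeMonoid_isMarkov_iff μ T α hα).2, fun μ _ hμ hα => ?_,
    fun μ _ hμ hα => ?_⟩
  · obtain ⟨h1, h2⟩ := FreeMarkov.freeGroup_isMarkov_iff μ (FreeMarkov.shiftAction μ hμ) _ hα
    exact ⟨h1, eq_comm.trans h2.symm⟩
  · obtain ⟨h1, h2⟩ := FreeMarkov.freeMonoid_isMarkov_iff μ (FreeMarkov.shiftAction μ hμ) _ hα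
    exact ⟨h1, eq_comm.trans h2.symm⟩
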